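/- Let $k$ be an algebraically closed field of characteristic $0$ and let $d\ge 1$. Let $\mathbb{P}^{2d+1}$ be the projective space of pairs $(F:G)$, not both zero and up to common scaling, of binary forms $F=\sum_{j=0}^d a_jX^{d-j}Y^j$, $G=\sum_{j=0}^d b_jX^{d-j}Y^j$ over $k$, with homogeneous coordinates $[a_0:\dots:a_d:b_0:\dots:b_d]$ and the Zariski topology; common factors of $F$ and $G$ are allowed. The group $\mathrm{PGL}_2(k)$ acts on $\mathbb{P}^{2d+1}$ by conjugation, $g\cdot\varphi=g\circ\varphi\circ g^{-1}$, where $g=\begin{pmatrix}\alpha&\beta\\ \gamma&\delta\end{pmatrix}$ acts on the source by the substitution $(X,Y)\mapsto(\alpha X+\beta Y,\gamma X+\delta Y)$ and on the target by $(F,G)\mapsto(\alpha F+\beta G,\gamma F+\delta G)$. Let $A\subset\mathbb{P}^{2d+1}$ be the automorphism locus, i.e. the set of points whose stabilizer in $\mathrm{PGL}_2(k)$ is nontrivial. Then $A$ has codimension $d-1$ in $\mathbb{P}^{2d+1}$. In particular every irreducible component of $A$, including those contained in the resultant hypersurface $\{\mathrm{Res}(F,G)=0\}$, has codimension at least $d-1$.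 (The codimension of a closed irreducible subset $Z$ is the supremum of the lengths $r$ of chains $Z=Z_0\subsetneq Z_1\subsetneq\dots\subsetneq Z_r$ of closed irreducible subsets of $\mathbb{P}^{2d+1}$; the codimension of an arbitrary subset is the infimum of the codimensions of the closed irreducible subsets of its closure.) -/

import Mathlib

open MvPolynomial
open scoped LinearAlgebra.Projectivization

noncomputable section

namespace RationalMaps

/-! ### The Zariski topology on projective space and codimension -/

section Zariski

variable {k σ : Type*} [Field k]

/-- The common zeros in `ℙ(k^σ)` of a set `S` of polynomials. It is used for homogeneous
polynomials only, for which the choice of the representative of a point does not matter. -/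
def zeroLocus (S : Set (MvPolynomial σ k)) : Set (ℙ k (σ → k)) :=
  {x | ∀ p ∈ S, eval x.rep p = 0}

/-- For homogeneous polynomials, vanishing can be tested on any representative of a point. -/
theorem eval_rep_eq_zero_iff {p : MvPolynomial σ k} {n : ℕ} (hp : p.IsHomogeneous n)
    (v : σ → k) (hv : v ≠ 0) :
    eval (Projectivization.mk k v hv).rep p = 0 ↔ eval v p = 0 := by
  obtain ⟨a, ha⟩ := Projectivization.exists_smul_eq_mk_rep k v hv
  rw [← ha]
  have h : eval (a • v) p = (a : k) ^ n * eval v p := by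
    rw [eval_eq, eval_eq, Finset.mul_sum]
    refine Finset.sum_congr rfl fun m hm => ?_
    have hdeg := hp (mem_support_iff.1 hm)
    have h2 : ∏ i ∈ m.support, (a • v) i ^ m i
        = (a : k) ^ n * ∏ i ∈ m.support, v i ^ m i := by
      simp only [Pi.smul_apply, Units.smul_def, smul_eq_mul, mul_pow, Finset.prod_mul_distrib,
        Finset.prod_pow_eq_pow_sum]
      congr 2
      rw [← hdeg, Finsupp.weight_apply]
      simp [Finsupp.sum]
    rw [h2]
    ring
  rw [h]
  simp

/-- The Zariski topology on `ℙ(k^σ)`: the closed sets are the zero loci of sets of homogeneous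
polynomials. -/
instance zariskiTopology : TopologicalSpace (ℙ k (σ → k)) :=
  TopologicalSpace.ofClosed
    {Z | ∃ S : Set (MvPolynomial σ k), (∀ p ∈ S, ∃ n, p.IsHomogeneous n) ∧ Z = zeroLocus S}
    ⟨{1}, fun p hp => ⟨0, by rw [Set.mem_singleton_iff.1 hp]; exact isHomogeneous_one σ k⟩, by
      ext x; simp [zeroLocus]⟩
    (by
      intro A hA
      refine ⟨{p | (∃ n, p.IsHomogeneous n) ∧ ∃ Z ∈ A, ∀ x ∈ Z, eval x.rep p = 0},
        fun p hp => hp.1, ?_⟩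
      ext x
      constructor
      · rintro hx p ⟨-, Z, hZ, h⟩
        exact h x (hx Z hZ)
      · intro hx Z hZ
        obtain ⟨S, hS, rfl⟩ := hA hZ
        intro p hp
        exact hx p ⟨hS p hp, _, hZ, fun y hy => hy p hp⟩)
    (by
      rintro _ ⟨S, hS, rfl⟩ _ ⟨T, hT, rfl⟩
      refine ⟨{r | ∃ p ∈ S, ∃ q ∈ T, r = p * q}, ?_, ?_⟩
      · rintro _ ⟨p, hp, q, hq, rfl⟩
        obtain ⟨m, hm⟩ := hS p hp
        obtain ⟨n, hn⟩ := hT q hq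
        exact ⟨m + n, hm.mul hn⟩
      · ext x
        constructor
        · rintro (h | h) _ ⟨p, hp, q, hq, rfl⟩
          · rw [map_mul, h p hp, zero_mul]
          · rw [map_mul, h q hq, mul_zero]
        · intro h
          by_contra hx
          rw [Set.mem_union, not_or] at hx
          obtain ⟨h1, h2⟩ := hx
          simp only [zeroLocus, Set.mem_ofPred_eq, not_forall] at h1 h2
          obtain ⟨p, hp, hp0⟩ := h1
          obtain ⟨q, hq, hq0⟩ := h2
          have := h _ ⟨p, hp, q, hq, rfl⟩
          rw [map_mul, mul_eq_zero] at this
          exact this.elim hp0 hq0)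

theorem isClosed_iff_zeroLocus {Z : Set (ℙ k (σ → k))} :
    IsClosed Z ↔
      ∃ S : Set (MvPolynomial σ k), (∀ p ∈ S, ∃ n, p.IsHomogeneous n) ∧ Z = zeroLocus S := by
  rw [← isOpen_compl_iff]
  change Zᶜᶜ ∈ _ ↔ _
  rw [compl_compl]
  rfl

end Zariski

/-- The codimension of a subset `A` of a topological space `X`. For a closed irreducible `Z` it is
the supremum of the lengths `r` of chains `Z = Z₀ < Z₁ < ⋯ < Zᵣ` of closed irreducible subsets
of `X`; in general it is the infimum of the codimensions of the closed irreducible subsets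
of the closure of `A`. -/
def codim {X : Type*} [TopologicalSpace X] (A : Set X) : ℕ∞ :=
  ⨅ (Z : TopologicalSpace.IrreducibleCloseds X) (_ : (Z : Set X) ⊆ closure A), Order.coheight Z

/-! ### Pairs of binary forms -/

section Forms

variable {k : Type*} [Field k]

/-- The binary form `c₀ X^d + c₁ X^(d-1) Y + ⋯ + c_d Y^d`, where `X = X 0` and `Y = X 1`. -/
def binaryForm (d : ℕ) (c : Fin (d + 1) → k) : MvPolynomial (Fin 2) k :=
  ∑ j : Fin (d + 1), C (c j) * X 0 ^ (d - (j : ℕ)) * X 1 ^ (j : ℕ)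

/-- The coefficients `c_j` of `X^(d-j) Y^j` in a polynomial. -/
def formCoeffs (d : ℕ) (p : MvPolynomial (Fin 2) k) : Fin (d + 1) → k :=
  fun j => coeff (Finsupp.single 0 (d - (j : ℕ)) + Finsupp.single 1 (j : ℕ)) p

/-- Linear change of variables: `F(X, Y) ↦ F(M₀₀ X + M₀₁ Y, M₁₀ X + M₁₁ Y)`. -/
def linSubst (M : Matrix (Fin 2) (Fin 2) k) : MvPolynomial (Fin 2) k →ₐ[k] MvPolynomial (Fin 2) k :=
  aeval fun i => ∑ j, C (M i j) * X j

theorem monomial_eq (d : ℕ) (j : Fin (d + 1)) (a : k) :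
    C a * X 0 ^ (d - (j : ℕ)) * X 1 ^ (j : ℕ)
      = monomial (Finsupp.single (0 : Fin 2) (d - (j : ℕ)) + Finsupp.single 1 (j : ℕ)) a := by
  rw [X_pow_eq_monomial, X_pow_eq_monomial, C_mul_monomial, monomial_mul]
  simp

theorem binaryForm_isHomogeneous (d : ℕ) (c : Fin (d + 1) → k) :
    (binaryForm d c).IsHomogeneous d := by
  refine IsHomogeneous.sum _ _ _ fun j _ => ?_
  have h := ((isHomogeneous_C (Fin 2) (c j)).mul
    ((isHomogeneous_X k (0 : Fin 2)).pow (d - (j : ℕ)))).mul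
    ((isHomogeneous_X k (1 : Fin 2)).pow (j : ℕ))
  have e : 0 + 1 * (d - (j : ℕ)) + 1 * (j : ℕ) = d := by have := j.2; omega
  rwa [e] at h

theorem formCoeffs_binaryForm (d : ℕ) (c : Fin (d + 1) → k) :
    formCoeffs d (binaryForm d c) = c := by
  funext i
  simp only [formCoeffs, binaryForm, monomial_eq, coeff_sum, coeff_monomial]
  rw [Finset.sum_eq_single i]
  · simp
  · intro j _ hj
    rw [if_neg]
    intro h
    have h1 := DFunLike.congr_fun h 1
    simp at h1
    exact hj (Fin.ext h1)
  · simp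

theorem binaryForm_formCoeffs (d : ℕ) {p : MvPolynomial (Fin 2) k} (hp : p.IsHomogeneous d) :
    binaryForm d (formCoeffs d p) = p := by
  ext m
  simp only [formCoeffs, binaryForm, monomial_eq, coeff_sum, coeff_monomial]
  by_cases hm : m 0 + m 1 = d
  · have hlt : m 1 < d + 1 := by omega
    have hmm : m = Finsupp.single 0 (d - m 1) + Finsupp.single 1 (m 1) := by
      ext i
      fin_cases i
      · simp; omega
      · simp
    rw [Finset.sum_eq_single ⟨m 1, hlt⟩]
    · dsimp only
      rw [← hmm]
      simp
    · intro j _ hj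
      rw [if_neg]
      intro h
      have h1 := DFunLike.congr_fun h 1
      simp at h1
      exact hj (Fin.ext h1)
    · simp
  · rw [hp.coeff_eq_zero (by rw [Finsupp.degree_eq_sum]; simpa using hm)]
    refine Finset.sum_eq_zero fun j _ => if_neg ?_
    rintro rfl
    apply hm
    have := j.2
    simp
    omega

theorem linSubst_isHomogeneous (M : Matrix (Fin 2) (Fin 2) k) {d : ℕ} {p : MvPolynomial (Fin 2) k}
    (hp : p.IsHomogeneous d) : (linSubst M p).IsHomogeneous d := by
  have h := hp.aeval (fun i => ∑ j, C (M i j) * X j : Fin 2 → MvPolynomial (Fin 2) k) (n := 1)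
    (fun i => IsHomogeneous.sum _ _ _ fun j _ => (isHomogeneous_X k j).C_mul _)
  rwa [one_mul] at h

theorem linSubst_one (p : MvPolynomial (Fin 2) k) : linSubst 1 p = p := by
  have h : linSubst (1 : Matrix (Fin 2) (Fin 2) k) = AlgHom.id k _ := by
    ext i : 1
    simp [linSubst, Matrix.one_apply]
  rw [h]
  rfl

theorem linSubst_mul (M N : Matrix (Fin 2) (Fin 2) k) (p : MvPolynomial (Fin 2) k) :
    linSubst (M * N) p = linSubst N (linSubst M p) := by
  have h : linSubst (M * N) = (linSubst N).comp (linSubst M) := by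
    ext i : 1
    simp [linSubst, Matrix.mul_apply, Fin.sum_univ_two, algebraMap_eq]
    ring
  rw [h]
  rfl

variable (k) in
/-- The affine space `𝔸^(2d+2)` of pairs `(F, G)` of binary forms of degree `d`. A pair is given by
its coefficients, those of `F` being `v (0, j)` and those of `G` being `v (1, j)`. -/
abbrev FormPair (d : ℕ) : Type _ := Fin 2 × Fin (d + 1) → k

/-- The two components of a pair: `v.form 0 = F` and `v.form 1 = G`. -/
def form {d : ℕ} (v : FormPair k d) (i : Fin 2) : MvPolynomial (Fin 2) k :=
  binaryForm d fun j => v (i, j)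

/-- The components of the conjugate `g ∘ (F, G) ∘ g⁻¹`. -/
def conjForm {d : ℕ} (g : GL (Fin 2) k) (v : FormPair k d) (i : Fin 2) :
    MvPolynomial (Fin 2) k :=
  ∑ l, C (g.val i l) * linSubst (g⁻¹).val (form v l)

/-- The conjugate `g ∘ (F, G) ∘ g⁻¹` of a pair of binary forms. -/
def conj {d : ℕ} (g : GL (Fin 2) k) (v : FormPair k d) : FormPair k d :=
  fun ij => formCoeffs d (conjForm g v ij.1) ij.2

theorem conjForm_isHomogeneous {d : ℕ} (g : GL (Fin 2) k) (v : FormPair k d) (i : Fin 2) :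
    (conjForm g v i).IsHomogeneous d :=
  IsHomogeneous.sum _ _ _ fun _ _ =>
    (linSubst_isHomogeneous _ (binaryForm_isHomogeneous d _)).C_mul _

theorem form_conj {d : ℕ} (g : GL (Fin 2) k) (v : FormPair k d) (i : Fin 2) :
    form (conj g v) i = conjForm g v i := by
  have h : (fun j => conj g v (i, j)) = formCoeffs d (conjForm g v i) := rfl
  rw [form, h, binaryForm_formCoeffs d (conjForm_isHomogeneous g v i)]

theorem form_injective {d : ℕ} {v w : FormPair k d} (h : ∀ i, form v i = form w i) : v = w := by
  funext ⟨i, j⟩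
  have := congrArg (formCoeffs d) (h i)
  rw [form, form, formCoeffs_binaryForm, formCoeffs_binaryForm] at this
  exact congrFun this j

theorem form_add {d : ℕ} (v w : FormPair k d) (i : Fin 2) :
    form (v + w) i = form v i + form w i := by
  simp [form, binaryForm, add_mul, Finset.sum_add_distrib]

theorem form_smul {d : ℕ} (a : k) (v : FormPair k d) (i : Fin 2) :
    form (a • v) i = C a * form v i := by
  simp [form, binaryForm, Finset.mul_sum, mul_assoc]

theorem form_zero {d : ℕ} (i : Fin 2) : form (0 : FormPair k d) i = 0 := by
  simp [form, binaryForm]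

theorem linSubst_C (M : Matrix (Fin 2) (Fin 2) k) (a : k) : linSubst M (C a) = C a := by
  simp [linSubst, algebraMap_eq]

/-- `GL₂` acts linearly on pairs of binary forms by `g • (F, G) = g ∘ (F, G) ∘ g⁻¹`. -/
instance conjAction (d : ℕ) : DistribMulAction (GL (Fin 2) k) (FormPair k d) where
  smul := conj
  one_smul v := form_injective fun i => by
    change form (conj 1 v) i = _
    rw [form_conj]
    simp [conjForm, linSubst_one, Matrix.one_apply]
  mul_smul g h v := form_injective fun i => by
    change form (conj (g * h) v) i = form (conj g (conj h v)) i
    rw [form_conj, form_conj]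
    simp only [conjForm, form_conj, mul_inv_rev, Units.val_mul, linSubst_mul, map_mul,
      Matrix.mul_apply, linSubst_C, Fin.sum_univ_two, map_add]
    ring
  smul_zero g := form_injective fun i => by
    change form (conj g 0) i = _
    rw [form_conj]
    simp [conjForm, form_zero]
  smul_add g v w := form_injective fun i => by
    change form (conj g (v + w)) i = form (conj g v + conj g w) i
    rw [form_add, form_conj, form_conj, form_conj]
    simp [conjForm, form_add, mul_add, Finset.sum_add_distrib]

theorem form_gl_smul {d : ℕ} (g : GL (Fin 2) k) (v : FormPair k d) (i : Fin 2) :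
    form (g • v) i = conjForm g v i :=
  form_conj g v i

instance conjAction_smulCommClass (d : ℕ) : SMulCommClass (GL (Fin 2) k) k (FormPair k d) where
  smul_comm g a v := form_injective fun i => by
    rw [form_gl_smul, form_smul, form_gl_smul]
    simp only [conjForm, form_smul, map_mul, linSubst_C, Fin.sum_univ_two]
    ring

theorem linSubst_scalar (a : k) {d : ℕ} (c : Fin (d + 1) → k) :
    linSubst (Matrix.scalar (Fin 2) a) (binaryForm d c) = C (a ^ d) * binaryForm d c := by
  simp only [binaryForm, map_sum, map_mul, map_pow, Finset.mul_sum, linSubst_C]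
  refine Finset.sum_congr rfl fun j _ => ?_
  have h : ∀ i, linSubst (Matrix.scalar (Fin 2) a) (X i) = C a * X i := by
    intro i
    fin_cases i <;> simp [linSubst, Matrix.scalar_apply, Matrix.diagonal_apply]
  have hj : (j : ℕ) ≤ d := Nat.lt_succ_iff.1 j.2
  have e : (C a : MvPolynomial (Fin 2) k) ^ d = C a ^ (d - (j : ℕ)) * C a ^ (j : ℕ) := by
    rw [← pow_add, Nat.sub_add_cancel hj]
  rw [h, h, e, mul_pow, mul_pow]
  ring

/-- `PGL₂` acts on `ℙ^(2d+1)`, the space of pairs `(F : G)` of binary forms of degree `d` up to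
scaling, by conjugation: `g • φ = g ∘ φ ∘ g⁻¹`. -/
instance pglAction (d : ℕ) :
    MulAction (Matrix.ProjGenLinGroup (Fin 2) k) (ℙ k (FormPair k d)) :=
  Matrix.ProjGenLinGroup.mulActionOfGL fun u => Projectivization.ind fun v hv => by
    simp only [Projectivization.smul_mk, Projectivization.mk_eq_mk_iff']
    refine ⟨(u : k) * ((u⁻¹ : kˣ) : k) ^ d, form_injective fun i => ?_⟩
    have hinv : (Matrix.GeneralLinearGroup.scalar (Fin 2) u)⁻¹
        = Matrix.GeneralLinearGroup.scalar (Fin 2) u⁻¹ := by rw [map_inv]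
    rw [form_gl_smul, form_smul, conjForm, hinv]
    have hs : ∀ w : kˣ, (Matrix.GeneralLinearGroup.scalar (Fin 2) w).val
        = Matrix.scalar (Fin 2) (w : k) := fun w => rfl
    simp only [hs, form, linSubst_scalar]
    fin_cases i <;> simp [Matrix.scalar_apply, Matrix.diagonal_apply, mul_assoc]

theorem pgl_smul_mk {d : ℕ} (g : GL (Fin 2) k) (v : FormPair k d) (hv : v ≠ 0) :
    Matrix.ProjGenLinGroup.mk g • Projectivization.mk k v hv
      = Projectivization.mk k (g • v) ((smul_ne_zero_iff_ne g).mpr hv) :=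
  rfl

end Forms

/-- The automorphism locus in `ℙ^(2d+1)`: the points `(F : G)` whose stabilizer in `PGL₂` is
nontrivial. -/
def automorphismLocus (k : Type*) [Field k] (d : ℕ) : Set (ℙ k (FormPair k d)) :=
  {φ | MulAction.stabilizer (Matrix.ProjGenLinGroup (Fin 2) k) φ ≠ ⊥}

end RationalMaps

end

/-!
The statement amounts to `dim A = d + 2`, and the proof counts parameters on affine cones.

If a nonscalar matrix `g` fixes the pair `(F : G)`, then `g = h K h⁻¹` with `K` in Jordan normal
form, so that `(F : G) = h ∘ w ∘ h⁻¹` for some `w` that `K` fixes up to a scalar. If `K` is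
diagonal with distinct entries, then for each `j` at most one of the two coefficients of `w` at
`X^(d-j) Y^j` is nonzero, which leaves `d + 1` parameters for `w`; if `K` is a Jordan block, then
`w` is from a space of dimension `2`. The matrix `h` can be normalized to depend on two parameters
(`exists_frame_mul_eq`), so `A` is covered by finitely many polynomial families with `d + 3`
parameters (`exists_mem_paramImage_family`), which are cones in an affine space of dimension
`2 d + 2`.

Lower bound. An irreducible closed subset of the closure of `A` lies in the closure `W` of one of
these families. Among the coordinates of the family choose a transcendence basis `T`, which has at
most `d + 3` members. Adding a free parameter to one coordinate outside `T` after the other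
produces a chain of irreducible closed sets above `W`. It is strict, since each step destroys the
algebraic relation between the coordinate in question and `T` (`le_coheight_paramClosure`).

Upper bound. Let `Z` be the closure of the family of conjugates of the pairs with `F` even and `G`
odd in `Y`, which are fixed by the conjugates of the involution `diag(1, -1)`. The Jacobian of
`d + 3` coordinates of the family is invertible at the pair `(X^d, 0)`, so these coordinates are
algebraically independent on the cone over `Z` (`algebraicIndependent_family`). Along a chain of
irreducible closed sets above `Z`, each step enlarges an algebraically independent family by an
equation that is lost (`algebraicIndependent_option_of_mem`). Since there are only `2 d + 2`
variables, the chain has length at most `d - 1` (`coheight_paramClosure_le`).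
-/

noncomputable section

namespace RationalMaps

/-! ### Algebraic independence of polynomials -/

section AlgebraicIndependence

variable {k : Type*} [Field k]

theorem card_le_of_algebraicIndependent {σ τ : Type*} [Fintype σ] [Fintype τ]
    {f : τ → MvPolynomial σ k} (hf : AlgebraicIndependent k f) :
    Fintype.card τ ≤ Fintype.card σ := by
  have h := hf.lift_cardinalMk_le_trdeg
  rw [MvPolynomial.trdeg_of_isDomain] at h
  simpa [Cardinal.mk_fintype] using h

/-- The chain rule for the substitution of polynomials into a polynomial. -/
theorem pderiv_aeval {ι τ : Type*} [Fintype τ] (f : τ → MvPolynomial ι k)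
    (P : MvPolynomial τ k) (j : ι) :
    pderiv j (aeval f P) = ∑ i, aeval f (pderiv i P) * pderiv j (f i) := by
  classical
  induction P using MvPolynomial.induction_on with
  | C a => simp [algebraMap_eq]
  | add p q hp hq => simp only [map_add, hp, hq, add_mul, Finset.sum_add_distrib]
  | mul_X p i hp =>
    simp only [map_mul, aeval_X, pderiv_mul, hp, pderiv_X, map_add, Pi.single_apply,
      add_mul, Finset.sum_add_distrib, Finset.sum_mul]
    congr 1
    · exact Finset.sum_congr rfl fun _ _ => by ring
    · rw [Finset.sum_eq_single i]
      · simp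
      · intro b _ hb
        simp [Ne.symm hb]
      · simp

/-- The Jacobian criterion: over a field of characteristic zero, as many polynomials as there are
variables are algebraically independent as soon as their Jacobian determinant is nonzero at one
point. A nontrivial relation of minimal degree would be differentiated to a relation of smaller
degree. -/
theorem algebraicIndependent_of_det_pderiv_ne_zero [CharZero k] {ι : Type*} [Fintype ι]
    [DecidableEq ι] (f : ι → MvPolynomial ι k) (p : ι → k)
    (hf : (Matrix.of fun i j => eval p (pderiv j (f i))).det ≠ 0) :
    AlgebraicIndependent k f := by
  rw [algebraicIndependent_iff]
  have hJ : (Matrix.of fun i j => pderiv j (f i)).det ≠ 0 := by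
    intro h
    apply hf
    have := congrArg (eval p) h
    rw [map_zero, RingHom.map_det] at this
    exact this
  intro P hP
  induction hn : P.totalDegree using Nat.strong_induction_on generalizing P with
  | _ n ih =>
    have hz : ∀ i, aeval f (pderiv i P) = 0 := by
      refine congrFun (Matrix.eq_zero_of_vecMul_eq_zero (v := fun i => aeval f (pderiv i P)) hJ ?_)
      funext j
      have := pderiv_aeval f P j
      rw [hP, map_zero] at this
      simpa [Matrix.vecMul, dotProduct] using this.symm
    have hd : ∀ i, pderiv i P = 0 := by
      intro i
      by_contra hne
      obtain ⟨m, hm⟩ := exists_coeff_ne_zero hne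
      have hlt : (pderiv i P).totalDegree < n := by
        have hpos : ∀ m, coeff m (pderiv i P) ≠ 0 → (m.sum fun _ e => e) + 1 ≤ n := by
          intro m hm
          rw [coeff_pderiv] at hm
          have h1 := le_totalDegree (mem_support_iff.2 (left_ne_zero_of_mul hm))
          rw [Finsupp.sum_add_index' (by simp) (by simp), hn] at h1
          simpa using h1
        rw [MvPolynomial.totalDegree, Finset.sup_lt_iff]
        · exact fun m hm => hpos m (mem_support_iff.1 hm)
        · exact lt_of_lt_of_le (Nat.succ_pos _) (hpos m hm)
      exact hne (ih _ hlt _ (hz i) rfl)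
    have hP' : P = C (coeff 0 P) := by
      ext m
      rw [coeff_C]
      split_ifs with h
      · rw [h]
      · obtain ⟨i, hi⟩ := Finsupp.ne_iff.1 (Ne.symm h)
        have h1 := coeff_pderiv (i := i) P (m - Finsupp.single i 1)
        rw [hd, coeff_zero,
          tsub_add_cancel_of_le (by simpa [Nat.one_le_iff_ne_zero] using hi)] at h1
        exact (mul_eq_zero.1 h1.symm).resolve_right (Nat.cast_add_one_ne_zero _)
    rw [hP'] at hP ⊢
    simpa [algebraMap_eq] using hP

/-- Let `I' ⊆ I` be ideals with `I'` prime. If a family is algebraically independent modulo `I`,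
then it stays so modulo `I'` after any element of `I` outside `I'` is adjoined to it: the
transcendence degree of the quotient drops strictly along a chain of primes. -/
theorem algebraicIndependent_option_of_mem {A : Type*} [CommRing A] [Algebra k A] {I I' : Ideal A}
    (hI : I' ≤ I) [I'.IsPrime] {a : A} (ha : a ∈ I) (ha' : a ∉ I') {τ : Type*} {T : τ → A}
    (hT : ∀ P : MvPolynomial τ k, aeval T P ∈ I → P = 0) (P : MvPolynomial (Option τ) k)
    (hP : aeval (fun o : Option τ => o.elim a T) P ∈ I') : P = 0 := by
  let θ : Polynomial (MvPolynomial τ k) →+* A :=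
    Polynomial.eval₂RingHom (aeval T : MvPolynomial τ k →ₐ[k] A).toRingHom a
  have hθ : ∀ P : MvPolynomial (Option τ) k,
      θ (optionEquivLeft k τ P) = aeval (fun o : Option τ => o.elim a T) P := by
    intro P
    induction P using MvPolynomial.induction_on with
    | C c => simp [θ, optionEquivLeft_C, ← algebraMap_eq]
    | add p q hp hq => simp only [map_add, hp, hq]
    | mul_X p i hp =>
      rw [map_mul, map_mul, map_mul, hp]
      cases i <;> simp [θ]
  have key : ∀ n, ∀ Q : Polynomial (MvPolynomial τ k), Q.natDegree ≤ n → θ Q ∈ I' → Q = 0 := by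
    intro n
    induction n with
    | zero =>
      intro Q hQ h
      rw [Polynomial.eq_C_of_natDegree_le_zero hQ] at h ⊢
      have : Q.coeff 0 = 0 := hT _ (hI (by simpa [θ] using h))
      simp [this]
    | succ n ih =>
      intro Q hQ h
      have e : θ Q = θ Q.divX * a + aeval T (Q.coeff 0) := by
        conv_lhs => rw [← Q.divX_mul_X_add]
        simp [θ]
      have h0 : Q.coeff 0 = 0 := by
        refine hT _ ?_
        have h1 : θ Q - θ Q.divX * a ∈ I := I.sub_mem (hI h) (I.mul_mem_left _ ha)
        rwa [e, add_sub_cancel_left] at h1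
      rw [h0, map_zero, add_zero] at e
      rw [e] at h
      have hQ' := ih Q.divX (by rw [Polynomial.natDegree_divX_eq_natDegree_tsub_one]; omega)
        ((Ideal.IsPrime.mem_or_mem inferInstance h).resolve_right ha')
      rw [← Q.divX_mul_X_add, hQ', h0]
      simp
  exact (map_eq_zero_iff _ (optionEquivLeft k τ).injective).1 (key _ _ le_rfl (by rwa [hθ]))

/-- A new variable is independent of an algebraically independent family of polynomials in the
old ones, at the level of values. -/
theorem eq_zero_of_eval_option_eq_zero [Infinite k] {ι τ : Type*} {f : τ → MvPolynomial ι k}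
    (hf : AlgebraicIndependent k f) (P : MvPolynomial (Option τ) k)
    (hP : ∀ (t : ι → k) (y : k), eval (fun o : Option τ => o.elim y fun i => eval t (f i)) P = 0) :
    P = 0 := by
  let θ : Polynomial (MvPolynomial τ k) →+* Polynomial (MvPolynomial ι k) :=
    Polynomial.mapRingHom (aeval f : MvPolynomial τ k →ₐ[k] MvPolynomial ι k).toRingHom
  have hθ : Function.Injective θ := Polynomial.map_injective _ hf
  have key : ∀ (P : MvPolynomial (Option τ) k) (t : ι → k) (y : k),
      ((θ (optionEquivLeft k τ P)).map (eval t)).eval y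
        = eval (fun o : Option τ => o.elim y fun i => eval t (f i)) P := by
    intro P t y
    induction P using MvPolynomial.induction_on with
    | C c => simp [θ, optionEquivLeft_C, algebraMap_eq]
    | add p q hp hq => simp only [map_add, Polynomial.map_add, Polynomial.eval_add, hp, hq]
    | mul_X p i hp =>
      simp only [map_mul, Polynomial.map_mul, Polynomial.eval_mul, hp]
      cases i <;> simp [θ]
  rw [← map_eq_zero_iff _ (optionEquivLeft k τ).injective, ← map_eq_zero_iff _ hθ]
  ext1 n
  rw [Polynomial.coeff_zero]
  refine MvPolynomial.funext fun t => ?_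
  have : (θ (optionEquivLeft k τ P)).map (eval t) = 0 :=
    Polynomial.funext fun y => by rw [key, hP]; simp
  rw [← Polynomial.coeff_map, this]
  simp

end AlgebraicIndependence

/-! ### Closed sets parametrized by polynomials -/

section Parametrization

variable {k σ ι : Type*} [Field k]

theorem mem_closure_iff_forall_homogeneous {S : Set (ℙ k (σ → k))} {x : ℙ k (σ → k)} :
    x ∈ closure S ↔ ∀ (p : MvPolynomial σ k) (n : ℕ), p.IsHomogeneous n →
      (∀ y ∈ S, eval y.rep p = 0) → eval x.rep p = 0 := by
  constructor
  · intro hx p n hp h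
    have hc : IsClosed (zeroLocus {p} : Set (ℙ k (σ → k))) :=
      isClosed_iff_zeroLocus.2 ⟨{p}, by rintro _ rfl; exact ⟨n, hp⟩, rfl⟩
    have hs : S ⊆ zeroLocus {p} := fun y hy q hq => by
      rw [Set.mem_singleton_iff.1 hq]; exact h y hy
    exact closure_minimal hs hc hx p rfl
  · intro h
    obtain ⟨T, hT, e⟩ := isClosed_iff_zeroLocus.1 (isClosed_closure (s := S))
    rw [e]
    intro p hp
    obtain ⟨n, hn⟩ := hT p hp
    refine h p n hn fun y hy => ?_
    have := subset_closure hy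
    rw [e] at this
    exact this p hp

/-- The points `(ψ_i(t))_i` of projective space, for all parameters `t` at which not all of the
polynomials `ψ_i` vanish. -/
def paramImage (ψ : σ → MvPolynomial ι k) : Set (ℙ k (σ → k)) :=
  {x | ∃ (t : ι → k) (h : (fun i => eval t (ψ i)) ≠ 0), x = Projectivization.mk k _ h}

theorem eval_bind₁ (ψ : σ → MvPolynomial ι k) (t : ι → k) (p : MvPolynomial σ k) :
    eval t (bind₁ ψ p) = eval (fun i => eval t (ψ i)) p := by
  have h := eval₂Hom_bind₁ (RingHom.id k) t ψ p
  exact h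

/-- A homogeneous polynomial that vanishes at the parametrized points, outside the zero set of
some nonzero polynomial `D` in the parameters, vanishes identically on the parametrization. -/
theorem bind₁_eq_zero_of_vanishing [Infinite k] {ψ : σ → MvPolynomial ι k}
    (hψ : (paramImage ψ).Nonempty) {D : MvPolynomial ι k} (hD : D ≠ 0) {p : MvPolynomial σ k}
    {n : ℕ} (hp : p.IsHomogeneous n)
    (h : ∀ (t : ι → k) (ht : (fun i => eval t (ψ i)) ≠ 0), eval t D ≠ 0 →
      eval (Projectivization.mk k _ ht).rep p = 0) : bind₁ ψ p = 0 := by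
  obtain ⟨_, t₀, h₀, -⟩ := hψ
  obtain ⟨i, hi⟩ := Function.ne_iff.1 h₀
  have hi' : ψ i ≠ 0 := by rintro e; simp [e] at hi
  have : bind₁ ψ p * D * ψ i = 0 := by
    refine MvPolynomial.funext fun t => ?_
    rw [map_mul, map_mul, map_zero]
    by_cases h1 : eval t (ψ i) = 0
    · rw [h1, mul_zero]
    by_cases h2 : eval t D = 0
    · rw [h2, mul_zero, zero_mul]
    have ht : (fun i => eval t (ψ i)) ≠ 0 := Function.ne_iff.2 ⟨i, h1⟩
    rw [eval_bind₁, (eval_rep_eq_zero_iff hp _ ht).1 (h t ht h2), zero_mul, zero_mul]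
  exact (mul_eq_zero.1 ((mul_eq_zero.1 this).resolve_right hi')).resolve_right hD

theorem eval_rep_eq_zero_of_bind₁_eq_zero {ψ : σ → MvPolynomial ι k} {p : MvPolynomial σ k} {n : ℕ}
    (hp : p.IsHomogeneous n) (h : bind₁ ψ p = 0) {x : ℙ k (σ → k)} (hx : x ∈ paramImage ψ) :
    eval x.rep p = 0 := by
  obtain ⟨t, ht, rfl⟩ := hx
  rw [eval_rep_eq_zero_iff hp, ← eval_bind₁, h, map_zero]

theorem paramImage_subset_closure [Infinite k] {ψ : σ → MvPolynomial ι k} {D : MvPolynomial ι k}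
    (hD : D ≠ 0) {S : Set (ℙ k (σ → k))}
    (h : ∀ (t : ι → k) (ht : (fun i => eval t (ψ i)) ≠ 0), eval t D ≠ 0 →
      Projectivization.mk k _ ht ∈ S) : paramImage ψ ⊆ closure S := by
  intro x hx
  rw [mem_closure_iff_forall_homogeneous]
  intro p n hp hpS
  exact eval_rep_eq_zero_of_bind₁_eq_zero hp
    (bind₁_eq_zero_of_vanishing ⟨x, hx⟩ hD hp fun t ht htD => hpS _ (h t ht htD)) hx

theorem isIrreducible_closure_paramImage [Infinite k] {ψ : σ → MvPolynomial ι k}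
    (hψ : (paramImage ψ).Nonempty) : IsIrreducible (closure (paramImage ψ)) := by
  rw [isIrreducible_iff_closure]
  refine ⟨hψ, isPreirreducible_iff_isClosed_union_isClosed.2 fun Z₁ Z₂ h₁ h₂ h => ?_⟩
  obtain ⟨S₁, hS₁, rfl⟩ := isClosed_iff_zeroLocus.1 h₁
  obtain ⟨S₂, hS₂, rfl⟩ := isClosed_iff_zeroLocus.1 h₂
  by_contra hne
  rw [not_or, Set.not_subset, Set.not_subset] at hne
  obtain ⟨⟨x, hx, hx'⟩, y, hy, hy'⟩ := hne
  simp only [zeroLocus, Set.mem_ofPred_eq, not_forall] at hx' hy'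
  obtain ⟨p, hp, hpx⟩ := hx'
  obtain ⟨q, hq, hqy⟩ := hy'
  obtain ⟨m, hm⟩ := hS₁ p hp
  obtain ⟨n, hn⟩ := hS₂ q hq
  have hpq : bind₁ ψ (p * q) = 0 := by
    refine bind₁_eq_zero_of_vanishing hψ one_ne_zero (hm.mul hn) fun t ht _ => ?_
    rw [map_mul]
    rcases h ⟨t, ht, rfl⟩ with h | h
    · rw [h p hp, zero_mul]
    · rw [h q hq, mul_zero]
  rw [map_mul, mul_eq_zero] at hpq
  rcases hpq with h | h
  · exact hpx (eval_rep_eq_zero_of_bind₁_eq_zero hm h hx)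
  · exact hqy (eval_rep_eq_zero_of_bind₁_eq_zero hn h hy)

/-- The closure of a nonempty parametrized set as an irreducible closed set. -/
def paramClosure [Infinite k] (ψ : σ → MvPolynomial ι k) (hψ : (paramImage ψ).Nonempty) :
    TopologicalSpace.IrreducibleCloseds (ℙ k (σ → k)) :=
  ⟨closure (paramImage ψ), isIrreducible_closure_paramImage hψ, isClosed_closure⟩

end Parametrization

/-! ### An upper bound for the codimension -/

section UpperBound

variable {k σ : Type*} [Field k]

/-- The homogeneous ideal of a subset of projective space: it is generated by the homogeneous
polynomials that vanish on the subset. -/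
def vanishingIdeal (Z : Set (ℙ k (σ → k))) : Ideal (MvPolynomial σ k) :=
  Ideal.span {p | (∃ n, p.IsHomogeneous n) ∧ ∀ x ∈ Z, eval x.rep p = 0}

theorem eval_rep_of_mem_vanishingIdeal {Z : Set (ℙ k (σ → k))} {p : MvPolynomial σ k}
    (hp : p ∈ vanishingIdeal Z) {x : ℙ k (σ → k)} (hx : x ∈ Z) : eval x.rep p = 0 := by
  have : vanishingIdeal Z ≤ RingHom.ker (eval x.rep) :=
    Ideal.span_le.2 fun q hq => hq.2 x hx
  exact this hp

theorem mem_vanishingIdeal_iff {Z : Set (ℙ k (σ → k))} {p : MvPolynomial σ k} {n : ℕ}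
    (hp : p.IsHomogeneous n) : p ∈ vanishingIdeal Z ↔ ∀ x ∈ Z, eval x.rep p = 0 :=
  ⟨fun h _ hx => eval_rep_of_mem_vanishingIdeal h hx, fun h => Ideal.subset_span ⟨⟨n, hp⟩, h⟩⟩

theorem vanishingIdeal_anti {Z W : Set (ℙ k (σ → k))} (h : Z ⊆ W) :
    vanishingIdeal W ≤ vanishingIdeal Z :=
  Ideal.span_mono fun _ hp => ⟨hp.1, fun x hx => hp.2 x (h hx)⟩

attribute [local instance] MvPolynomial.gradedAlgebra in
theorem isPrime_vanishingIdeal {Z : Set (ℙ k (σ → k))} (hZ : IsIrreducible Z) :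
    (vanishingIdeal Z).IsPrime := by
  have hhom : (vanishingIdeal Z).IsHomogeneous (homogeneousSubmodule σ k) :=
    Ideal.homogeneous_span _ _ fun p hp => hp.1
  obtain ⟨x₀, hx₀⟩ := hZ.nonempty
  refine hhom.isPrime_of_homogeneous_mem_or_mem ?_ ?_
  · intro h
    have h1 : (1 : MvPolynomial σ k) ∈ vanishingIdeal Z := h ▸ Submodule.mem_top
    simpa using eval_rep_of_mem_vanishingIdeal h1 hx₀
  · rintro p q ⟨m, hm⟩ ⟨n, hn⟩ hpq
    have hm : p.IsHomogeneous m := hm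
    have hn : q.IsHomogeneous n := hn
    rw [mem_vanishingIdeal_iff hm, mem_vanishingIdeal_iff hn]
    have := isPreirreducible_iff_isClosed_union_isClosed.1 hZ.isPreirreducible (zeroLocus {p})
      (zeroLocus {q}) (isClosed_iff_zeroLocus.2 ⟨{p}, by rintro _ rfl; exact ⟨m, hm⟩, rfl⟩)
      (isClosed_iff_zeroLocus.2 ⟨{q}, by rintro _ rfl; exact ⟨n, hn⟩, rfl⟩) fun x hx => by
        have := eval_rep_of_mem_vanishingIdeal hpq hx
        rw [map_mul, mul_eq_zero] at this
        simpa [zeroLocus] using this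
    refine this.imp (fun h x hx => h hx p rfl) fun h x hx => h hx q rfl

theorem exists_mem_vanishingIdeal_of_lt
    {Z W : TopologicalSpace.IrreducibleCloseds (ℙ k (σ → k))} (h : Z < W) :
    ∃ p ∈ vanishingIdeal (Z : Set (ℙ k (σ → k))), p ∉ vanishingIdeal (W : Set (ℙ k (σ → k))) := by
  obtain ⟨x, hxW, hxZ⟩ := Set.not_subset.1
    (show ¬ (W : Set (ℙ k (σ → k))) ⊆ Z from fun hle => h.not_ge hle)
  rw [← Z.isClosed.closure_eq, mem_closure_iff_forall_homogeneous] at hxZ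
  push Not at hxZ
  obtain ⟨p, n, hp, hpZ, hpx⟩ := hxZ
  exact ⟨p, (mem_vanishingIdeal_iff hp).2 hpZ,
    fun h => hpx (eval_rep_of_mem_vanishingIdeal h hxW)⟩

/-- A chain of irreducible closed sets above `Z` of length `n` and `r` polynomials that are
algebraically independent on the cone over `Z` satisfy `r + n ≤ #σ`: a homogeneous equation of each
member of the chain that does not hold on the next one can be adjoined to the `r` polynomials. -/
theorem card_add_le_of_le_coheight [Fintype σ] (n : ℕ) :
    ∀ {τ : Type*} [Fintype τ] (Z : TopologicalSpace.IrreducibleCloseds (ℙ k (σ → k)))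
      (T : τ → MvPolynomial σ k)
      (_ : ∀ P : MvPolynomial τ k, aeval T P ∈ vanishingIdeal (Z : Set (ℙ k (σ → k))) → P = 0),
      (n : ℕ∞) ≤ Order.coheight Z → Fintype.card τ + n ≤ Fintype.card σ := by
  induction n with
  | zero =>
    intro τ _ Z T hT _
    refine card_le_of_algebraicIndependent (f := T) ?_
    rw [algebraicIndependent_iff]
    exact fun P hP => hT P (hP ▸ Ideal.zero_mem _)
  | succ n ih =>
    intro τ _ Z T hT hn
    obtain ⟨W, hZW, hW⟩ : ∃ W, Z < W ∧ (n : ℕ∞) ≤ Order.coheight W := by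
      by_contra hcon
      push Not at hcon
      have := Order.coheight_le_coe_iff.2 hcon
      have := hn.trans this
      norm_cast at this
      omega
    obtain ⟨p, hpZ, hpW⟩ := exists_mem_vanishingIdeal_of_lt hZW
    have := isPrime_vanishingIdeal W.isIrreducible
    have := ih W (fun o : Option τ => o.elim p T)
      (algebraicIndependent_option_of_mem (vanishingIdeal_anti hZW.le) hpZ hpW hT) hW
    rw [Fintype.card_option] at this
    omega

/-- If polynomials `ψ_i` with `i ∈ T` in the parametrization are algebraically independent,
then the parametrized closed set has codimension at most the number of the remaining `ψ_i`. -/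
theorem coheight_paramClosure_le [Infinite k] [Fintype σ] {ι τ : Type*} [Fintype τ]
    {ψ : σ → MvPolynomial ι k} (hψ : (paramImage ψ).Nonempty) {e : τ → σ}
    (he : AlgebraicIndependent k fun i => ψ (e i)) {m : ℕ}
    (hm : Fintype.card σ ≤ Fintype.card τ + m) : Order.coheight (paramClosure ψ hψ) ≤ m := by
  by_contra! hlt
  have h1 : ((m + 1 : ℕ) : ℕ∞) ≤ Order.coheight (paramClosure ψ hψ) := by
    push_cast
    exact Order.add_one_le_of_lt hlt
  have := card_add_le_of_le_coheight (m + 1) (paramClosure ψ hψ) (fun i => X (e i)) ?_ h1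
  · omega
  · intro P hP
    rw [algebraicIndependent_iff] at he
    apply he
    have hle : vanishingIdeal (closure (paramImage ψ)) ≤ RingHom.ker (bind₁ ψ) := by
      refine Ideal.span_le.2 ?_
      rintro p ⟨⟨n, hp⟩, h⟩
      exact bind₁_eq_zero_of_vanishing hψ one_ne_zero hp
        fun t ht _ => h _ (subset_closure ⟨t, ht, rfl⟩)
    have h2 : bind₁ ψ (aeval (fun i => X (e i)) P) = 0 := hle hP
    rw [← h2]
    have : (aeval fun i => ψ (e i) : MvPolynomial τ k →ₐ[k] MvPolynomial ι k)
        = (bind₁ ψ).comp (aeval fun i => X (e i)) := by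
      ext i : 1
      simp
    rw [this]
    rfl

end UpperBound

/-! ### A lower bound for the codimension -/

section LowerBound

variable {k σ ι : Type*} [Field k]

theorem eval_smul_of_isHomogeneous {p : MvPolynomial σ k} {n : ℕ} (hp : p.IsHomogeneous n)
    (c : k) (v : σ → k) : eval (c • v) p = c ^ n * eval v p := by
  rw [eval_eq, eval_eq, Finset.mul_sum]
  refine Finset.sum_congr rfl fun m hm => ?_
  have h : ∏ i ∈ m.support, c ^ m i = c ^ n := by
    rw [Finset.prod_pow_eq_pow_sum, ← hp (mem_support_iff.1 hm), Finsupp.weight_apply]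
    simp [Finsupp.sum]
  simp only [Pi.smul_apply, smul_eq_mul, mul_pow, Finset.prod_mul_distrib, h]
  ring

/-- A polynomial that vanishes on a line through the origin has homogeneous components that
vanish there. -/
theorem eval_homogeneousComponent_eq_zero [Infinite k] {p : MvPolynomial σ k} {v : σ → k}
    (h : ∀ c : k, eval (c • v) p = 0) (n : ℕ) : eval v (homogeneousComponent n p) = 0 := by
  let q : Polynomial k := ∑ m ∈ Finset.range (p.totalDegree + 1),
    Polynomial.C (eval v (homogeneousComponent m p)) * Polynomial.X ^ m
  have hq : q = 0 := by
    refine Polynomial.funext fun c => ?_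
    have h1 := h c
    rw [← sum_homogeneousComponent p, map_sum] at h1
    simp only [eval_smul_of_isHomogeneous (homogeneousComponent_isHomogeneous _ _)] at h1
    rw [Polynomial.eval_zero, ← h1, Polynomial.eval_finsetSum]
    refine Finset.sum_congr rfl fun m _ => ?_
    rw [Polynomial.eval_mul, Polynomial.eval_C, Polynomial.eval_pow, Polynomial.eval_X, mul_comm]
  by_cases hn : n < p.totalDegree + 1
  · have h2 : q.coeff n = 0 := by rw [hq, Polynomial.coeff_zero]
    simpa [q, Polynomial.finsetSum_coeff, Polynomial.coeff_C_mul, Polynomial.coeff_X_pow, hn]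
      using h2
  · rw [homogeneousComponent_eq_zero n p (by omega), map_zero]

section Translate

variable [DecidableEq σ]

/-- The parametrization `ψ` with an additional free parameter added to each of the coordinates
in `R`. -/
def translate (ψ : σ → MvPolynomial ι k) (R : Finset σ) (i : σ) : MvPolynomial (ι ⊕ σ) k :=
  rename Sum.inl (ψ i) + if i ∈ R then X (Sum.inr i) else 0

theorem eval_translate (ψ : σ → MvPolynomial ι k) (R : Finset σ) (u : ι ⊕ σ → k) (i : σ) :
    eval u (translate ψ R i)
      = eval (fun j => u (Sum.inl j)) (ψ i) + if i ∈ R then u (Sum.inr i) else 0 := by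
  rw [translate, map_add, eval_rename]
  split_ifs <;> simp [Function.comp_def]

theorem paramImage_translate_empty (ψ : σ → MvPolynomial ι k) :
    paramImage (translate ψ ∅) = paramImage ψ := by
  ext x
  constructor
  · rintro ⟨u, hu, rfl⟩
    have e : (fun i => eval u (translate ψ ∅ i))
        = fun i => eval (fun j => u (Sum.inl j)) (ψ i) := by
      funext i; simp [eval_translate]
    exact ⟨fun j => u (Sum.inl j), e ▸ hu, by simp only [e]⟩
  · rintro ⟨t, ht, rfl⟩
    have e : (fun i => eval (Sum.elim t 0) (translate ψ ∅ i)) = fun i => eval t (ψ i) := by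
      funext i; simp [eval_translate]
    exact ⟨Sum.elim t 0, by rwa [e], by simp only [e]⟩

theorem paramImage_translate_mono (ψ : σ → MvPolynomial ι k) {R R' : Finset σ} (h : R ⊆ R') :
    paramImage (translate ψ R) ⊆ paramImage (translate ψ R') := by
  rintro _ ⟨u, hu, rfl⟩
  have e : (fun i => eval (Sum.elim (fun j => u (Sum.inl j))
      fun i => if i ∈ R then u (Sum.inr i) else 0) (translate ψ R' i))
      = fun i => eval u (translate ψ R i) := by
    funext i
    by_cases hi : i ∈ R
    · simp [eval_translate, hi, h hi]
    · simp [eval_translate, hi]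
  exact ⟨_, by rwa [e], by simp only [e]⟩

/-- A nontrivial algebraic relation between the coordinates in `T` and the coordinate `x` is lost
once a free parameter is added to the coordinate `x`. -/
theorem not_paramImage_translate_insert_subset [Infinite k] {ψ : σ → MvPolynomial ι k}
    (hψ : (paramImage ψ).Nonempty)
    (hscale : ∀ (t : ι → k) (c : k), ∃ t', ∀ i, eval t' (ψ i) = c * eval t (ψ i))
    {T R : Finset σ} (hTR : Disjoint T R) (hT : AlgebraicIndependent k fun i : T => ψ i)
    {x : σ} (hxT : x ∉ T) (hxR : x ∉ R)
    (hx : ¬ AlgebraicIndependent k fun o : Option T => o.elim (ψ x) fun i => ψ i) :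
    ¬ paramImage (translate ψ (insert x R)) ⊆ closure (paramImage (translate ψ R)) := by
  intro hsub
  rw [algebraicIndependent_iff] at hx
  push Not at hx
  obtain ⟨P, hP, hP0⟩ := hx
  apply hP0
  let e : Option T → σ := fun o => o.elim x fun i => i
  have hnotR : ∀ i : T, (i : σ) ∉ R := fun i hi => Finset.disjoint_left.1 hTR i.2 hi
  have hPψ : ∀ t : ι → k, eval (fun o => eval t (ψ (e o))) P = 0 := by
    intro t
    have h1 : bind₁ (fun o : Option T => ψ (e o)) P = 0 := by
      rw [← hP]
      congr 2
      funext o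
      cases o <;> rfl
    rw [← eval_bind₁ (fun o : Option T => ψ (e o)), h1, map_zero]
  have hzero : ∀ u : ι ⊕ σ → k, eval (fun i => eval u (translate ψ R i)) (rename e P) = 0 := by
    intro u
    rw [eval_rename, ← hPψ fun j => u (Sum.inl j)]
    congr 2
    funext o
    cases o with
    | none => simp [e, eval_translate, hxR]
    | some i => simp [e, eval_translate, hnotR]
  have hcone : ∀ (u : ι ⊕ σ → k) (c : k),
      eval (c • fun i => eval u (translate ψ R i)) (rename e P) = 0 := by
    intro u c
    obtain ⟨t', ht'⟩ := hscale (fun j => u (Sum.inl j)) c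
    rw [← hzero (Sum.elim t' fun i => c * u (Sum.inr i))]
    congr 2
    funext i
    simp only [Pi.smul_apply, smul_eq_mul, eval_translate, Sum.elim_inl, Sum.elim_inr, ht']
    split_ifs <;> ring
  have hne : (paramImage (translate ψ (insert x R))).Nonempty := by
    rw [← paramImage_translate_empty] at hψ
    exact hψ.mono (paramImage_translate_mono ψ (Finset.empty_subset _))
  have hbind : bind₁ (translate ψ (insert x R)) (rename e P) = 0 := by
    rw [← sum_homogeneousComponent (rename e P), map_sum]
    refine Finset.sum_eq_zero fun n _ => ?_
    have hn := homogeneousComponent_isHomogeneous n (rename e P)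
    refine bind₁_eq_zero_of_vanishing hne one_ne_zero hn fun u hu _ => ?_
    refine mem_closure_iff_forall_homogeneous.1 (hsub ⟨u, hu, rfl⟩) _ n hn ?_
    rintro _ ⟨w, hw, rfl⟩
    rw [eval_rep_eq_zero_iff hn]
    exact eval_homogeneousComponent_eq_zero (hcone w) n
  refine eq_zero_of_eval_option_eq_zero hT P fun t y => ?_
  have h2 := congrArg (eval (Sum.elim t fun _ => y - eval t (ψ x))) hbind
  rw [eval_bind₁, eval_rename, map_zero] at h2
  rw [← h2]
  congr 2
  funext o
  cases o with
  | none => simp [e, eval_translate]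
  | some i =>
    have : (i : σ) ≠ x := fun h => hxT (h ▸ i.2)
    simp [e, eval_translate, hnotR, this]

end Translate

/-- A closed set parametrized by a cone has codimension at least the number of coordinates minus
the number of parameters. If the coordinates in `T` form a transcendence basis among all
coordinates, then freeing the others one at a time yields a chain above the closed set. -/
theorem le_coheight_paramClosure [Infinite k] [Fintype σ] [Fintype ι] {ψ : σ → MvPolynomial ι k}
    (hψ : (paramImage ψ).Nonempty)
    (hscale : ∀ (t : ι → k) (c : k), ∃ t', ∀ i, eval t' (ψ i) = c * eval t (ψ i))
    {m : ℕ} (hm : Fintype.card ι + m ≤ Fintype.card σ) :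
    (m : ℕ∞) ≤ Order.coheight (paramClosure ψ hψ) := by
  classical
  obtain ⟨T, hT⟩ : ∃ T,
      Maximal (fun T : Finset σ => AlgebraicIndependent k fun i : T => ψ i) T := by
    refine (Set.toFinite {T : Finset σ | AlgebraicIndependent k fun i : T => ψ i}).exists_maximal
      ⟨∅, ?_⟩
    exact algebraicIndependent_empty_type_iff.2 (FaithfulSMul.algebraMap_injective k _)
  have hcard : T.card ≤ Fintype.card ι := by
    simpa using card_le_of_algebraicIndependent hT.prop
  have hmax : ∀ x ∉ T, ¬ AlgebraicIndependent k fun o : Option T => o.elim (ψ x) fun i => ψ i := by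
    intro x hx h
    have h1 : AlgebraicIndependent k fun i : (insert x T : Finset σ) => ψ i := by
      rw [← algebraicIndependent_equiv (Finset.subtypeInsertEquivOption hx).symm]
      convert h using 1
      funext o
      cases o <;> rfl
    exact hx (hT.2 h1 (Finset.subset_insert x T) (Finset.mem_insert_self x T))
  have hne : ∀ R : Finset σ, (paramImage (translate ψ R)).Nonempty := by
    intro R
    have h := hψ
    rw [← paramImage_translate_empty] at h
    exact h.mono (paramImage_translate_mono ψ (Finset.empty_subset _))
  have key : ∀ (n : ℕ) (R : Finset σ), Disjoint T R → (T ∪ R)ᶜ.card = n →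
      (n : ℕ∞) ≤ Order.coheight (paramClosure (translate ψ R) (hne R)) := by
    intro n
    induction n with
    | zero => simp
    | succ n ih =>
      intro R hTR hn
      obtain ⟨x, hx⟩ := Finset.card_pos.1 (hn.symm ▸ Nat.succ_pos n : 0 < (T ∪ R)ᶜ.card)
      have hxT : x ∉ T := fun h => Finset.mem_compl.1 hx (Finset.mem_union_left _ h)
      have hxR : x ∉ R := fun h => Finset.mem_compl.1 hx (Finset.mem_union_right _ h)
      have h1 := ih (insert x R) (Finset.disjoint_insert_right.2 ⟨hxT, hTR⟩) (by
        rw [Finset.union_insert, Finset.compl_insert, Finset.card_erase_of_mem hx, hn]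
        rfl)
      have hlt : paramClosure (translate ψ R) (hne R)
          < paramClosure (translate ψ (insert x R)) (hne _) := by
        refine lt_of_le_not_ge
          (closure_mono (paramImage_translate_mono ψ (Finset.subset_insert x R))) fun hle => ?_
        exact not_paramImage_translate_insert_subset hψ hscale hTR hT.prop hxT hxR (hmax x hxT)
          (subset_closure.trans hle)
      push_cast
      exact (add_le_add_left h1 1).trans (Order.coheight_add_one_le hlt)
  have h0 : paramClosure (translate ψ ∅) (hne ∅) = paramClosure ψ hψ :=
    TopologicalSpace.IrreducibleCloseds.ext (congrArg closure (paramImage_translate_empty ψ))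
  rw [← h0]
  refine le_trans ?_ (key _ ∅ (Finset.disjoint_empty_right _) rfl)
  rw [Finset.union_empty, Finset.card_compl]
  exact_mod_cast by omega

end LowerBound

/-! ### Conjugation with polynomial coefficients -/

section Twist

/-- The coefficient of `X^(d-j) Y^j` in `(N₀₀ X + N₀₁ Y)^(d-q) (N₁₀ X + N₁₁ Y)^q`. -/
def substCoeff {R : Type*} [CommRing R] {d : ℕ} (N : Matrix (Fin 2) (Fin 2) R)
    (q j : Fin (d + 1)) : R :=
  coeff (Finsupp.single 0 (d - (j : ℕ)) + Finsupp.single 1 (j : ℕ))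
    ((∑ i, C (N 0 i) * X i) ^ (d - (q : ℕ)) * (∑ i, C (N 1 i) * X i) ^ (q : ℕ) :
      MvPolynomial (Fin 2) R)

/-- The coefficients of the composition `M ∘ (F, G) ∘ N`, where `v` contains the coefficients of
the binary forms `F` and `G`. The matrices `M` and `N` are independent of each other, and all
entries are from an arbitrary commutative ring. -/
def twist {R : Type*} [CommRing R] {d : ℕ} (M N : Matrix (Fin 2) (Fin 2) R)
    (v : Fin 2 × Fin (d + 1) → R) (x : Fin 2 × Fin (d + 1)) : R :=
  ∑ l, M x.1 l * ∑ q, v (l, q) * substCoeff N q x.2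

variable {R S : Type*} [CommRing R] [CommRing S] {d : ℕ}

theorem map_substCoeff (f : R →+* S) (N : Matrix (Fin 2) (Fin 2) R) (q j : Fin (d + 1)) :
    f (substCoeff N q j) = substCoeff (N.map f) q j := by
  rw [substCoeff, substCoeff, ← coeff_map]
  simp

theorem map_twist (f : R →+* S) (M N : Matrix (Fin 2) (Fin 2) R) (v : Fin 2 × Fin (d + 1) → R)
    (x : Fin 2 × Fin (d + 1)) :
    f (twist M N v x) = twist (M.map f) (N.map f) (fun y => f (v y)) x := by
  simp [twist, map_substCoeff]

theorem twist_smul (c : R) (M N : Matrix (Fin 2) (Fin 2) R) (v : Fin 2 × Fin (d + 1) → R) :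
    twist M N (c • v) = c • twist M N v := by
  funext x
  simp only [twist, Pi.smul_apply, smul_eq_mul, Finset.mul_sum]
  exact Finset.sum_congr rfl fun _ _ => Finset.sum_congr rfl fun _ _ => by ring

theorem substCoeff_smul (c : R) (N : Matrix (Fin 2) (Fin 2) R) (q j : Fin (d + 1)) :
    substCoeff (c • N) q j = c ^ d * substCoeff N q j := by
  have h : ∀ i, (∑ l, C ((c • N) i l) * X l : MvPolynomial (Fin 2) R)
      = C c * ∑ l, C (N i l) * X l := by
    intro i
    simp [mul_add, mul_assoc]
  have hq : (C c : MvPolynomial (Fin 2) R) ^ d = C c ^ (d - (q : ℕ)) * C c ^ (q : ℕ) := by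
    rw [← pow_add, Nat.sub_add_cancel (Nat.lt_succ_iff.1 q.2)]
  rw [substCoeff, substCoeff, ← coeff_C_mul, C_pow, hq, h, h, mul_pow, mul_pow]
  congr 1
  ring

theorem twist_smul_right (c : R) (M N : Matrix (Fin 2) (Fin 2) R) (v : Fin 2 × Fin (d + 1) → R) :
    twist M (c • N) v = c ^ d • twist M N v := by
  funext x
  simp only [twist, substCoeff_smul, Pi.smul_apply, smul_eq_mul, Finset.mul_sum]
  exact Finset.sum_congr rfl fun _ _ => Finset.sum_congr rfl fun _ _ => by ring

theorem gl_smul_eq_twist {k : Type*} [Field k] (g : GL (Fin 2) k) (v : FormPair k d) :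
    g • v = twist g.val (g⁻¹).val v := by
  funext ⟨i, j⟩
  change formCoeffs d (conjForm g v i) j = _
  simp only [formCoeffs, conjForm, coeff_sum, coeff_C_mul, twist, form, binaryForm, map_sum,
    substCoeff]
  refine Finset.sum_congr rfl fun l _ => congrArg _ (Finset.sum_congr rfl fun q _ => ?_)
  rw [map_mul, map_mul, linSubst_C, mul_assoc, coeff_C_mul]
  simp [linSubst]

/-- Composing with the adjugate instead of the inverse only rescales the pair of forms. -/
theorem twist_adjugate {k : Type*} [Field k] (g : GL (Fin 2) k) (v : FormPair k d) :
    twist g.val g.val.adjugate v = g.val.det ^ d • (g • v) := by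
  have h : g.val.adjugate = g.val.det • (g⁻¹).val := by
    rw [Matrix.coe_units_inv, Matrix.inv_def, smul_smul, Ring.mul_inverse_cancel, one_smul]
    exact (Matrix.isUnit_iff_isUnit_det _).1 g.isUnit
  rw [h, twist_smul_right, gl_smul_eq_twist]

end Twist

/-! ### Pairs of forms fixed by a linear map -/

section Fixed

variable {k : Type*} [Field k] {d : ℕ}

theorem gl_smul_eq_smul_iff (g : GL (Fin 2) k) (c : k) (w : FormPair k d) :
    g • w = c • w ↔
      ∀ i, ∑ l, C (g.val i l) * form w l = C c * linSubst g.val (form w i) := by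
  have hinv : ∀ p : MvPolynomial (Fin 2) k, linSubst g.val (linSubst (g⁻¹).val p) = p := by
    intro p
    rw [← linSubst_mul, ← Units.val_mul, inv_mul_cancel, Units.val_one, linSubst_one]
  have hinv' : ∀ p : MvPolynomial (Fin 2) k, linSubst (g⁻¹).val (linSubst g.val p) = p := by
    intro p
    rw [← linSubst_mul, ← Units.val_mul, mul_inv_cancel, Units.val_one, linSubst_one]
  constructor
  · intro h i
    have h1 := congrArg (fun u => linSubst g.val (form u i)) h
    simp only [form_gl_smul, form_smul, conjForm, map_sum, map_mul, linSubst_C, hinv] at h1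
    exact h1
  · intro h
    refine form_injective fun i => ?_
    have h1 := congrArg (linSubst (g⁻¹).val) (h i)
    simp only [map_sum, map_mul, linSubst_C, hinv'] at h1
    rw [form_gl_smul, form_smul, conjForm, h1]

theorem linSubst_diagonal (a b : k) (c : Fin (d + 1) → k) :
    linSubst !![a, 0; 0, b] (binaryForm d c)
      = binaryForm d fun j => a ^ (d - (j : ℕ)) * b ^ (j : ℕ) * c j := by
  simp only [binaryForm, map_sum, map_mul, map_pow, linSubst_C]
  refine Finset.sum_congr rfl fun j _ => ?_
  simp [linSubst, mul_pow]
  ring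

theorem diagonal_smul_eq_smul_iff (g : GL (Fin 2) k) {a b : k} (hg : g.val = !![a, 0; 0, b])
    (c : k) (w : FormPair k d) :
    g • w = c • w ↔ ∀ j : Fin (d + 1),
      a * w (0, j) = c * (a ^ (d - (j : ℕ)) * b ^ (j : ℕ) * w (0, j)) ∧
      b * w (1, j) = c * (a ^ (d - (j : ℕ)) * b ^ (j : ℕ) * w (1, j)) := by
  have hC : ∀ (x : k) (u : Fin (d + 1) → k),
      C x * binaryForm d u = binaryForm d fun j => x * u j := by
    intro x u
    simp [binaryForm, Finset.mul_sum, mul_assoc]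
  have hinj : ∀ u u' : Fin (d + 1) → k, binaryForm d u = binaryForm d u' ↔ ∀ j, u j = u' j := by
    intro u u'
    refine ⟨fun h j => ?_, fun h => by rw [funext h]⟩
    rw [← formCoeffs_binaryForm d u, h, formCoeffs_binaryForm]
  have hz : (binaryForm d fun _ => (0 : k)) = 0 := by simp [binaryForm]
  rw [gl_smul_eq_smul_iff, hg]
  simp [Fin.forall_fin_two, form, linSubst_diagonal, hC, hz, hinj, forall_and]

/-- A polynomial that is proportional to its translate by a nonzero constant is constant. -/
theorem eq_C_of_eq_C_mul_comp [CharZero k] {p : Polynomial k} {c e : k} (he : e ≠ 0)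
    (h : p = Polynomial.C c * p.comp (Polynomial.X + Polynomial.C e)) :
    p = Polynomial.C (p.eval 0) ∧ (p ≠ 0 → c = 1) := by
  have hc : p ≠ 0 → c = 1 := by
    intro hp
    have h1 := congrArg Polynomial.leadingCoeff h
    rw [Polynomial.leadingCoeff_mul, Polynomial.leadingCoeff_C, Polynomial.leadingCoeff_comp
      (by simp), Polynomial.leadingCoeff_X_add_C, one_pow, mul_one] at h1
    exact mul_right_cancel₀ (Polynomial.leadingCoeff_ne_zero.2 hp) (by rw [← h1, one_mul])
  refine ⟨?_, hc⟩
  by_cases hp : p = 0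
  · simp [hp]
  rw [hc hp, map_one, one_mul] at h
  have hev : ∀ n : ℕ, p.eval (n * e) = p.eval 0 := by
    intro n
    induction n with
    | zero => simp
    | succ n ih =>
      rw [← ih]
      conv_rhs => rw [h]
      simp [add_mul]
  refine Polynomial.eq_of_infinite_eval_eq _ _ (Set.infinite_of_injective_forall_mem
    (f := fun n : ℕ => (n : k) * e) (fun m n hmn => ?_) fun n => by simp [hev])
  exact Nat.cast_injective (mul_right_cancel₀ he hmn)

/-- The polynomial `F(x, 1)` of a binary form `F`. -/
def dehomogenize (c : Fin (d + 1) → k) : Polynomial k :=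
  ∑ j, Polynomial.C (c j) * Polynomial.X ^ (d - (j : ℕ))

theorem coeff_dehomogenize (c : Fin (d + 1) → k) (j : Fin (d + 1)) :
    (dehomogenize c).coeff (d - (j : ℕ)) = c j := by
  rw [dehomogenize, Polynomial.finsetSum_coeff, Finset.sum_eq_single j]
  · simp
  · intro i _ hij
    rw [Polynomial.coeff_C_mul, Polynomial.coeff_X_pow, if_neg, mul_zero]
    intro h
    exact hij (Fin.ext (by omega))
  · simp

theorem aeval_binaryForm (c : Fin (d + 1) → k) :
    aeval ![Polynomial.X, 1] (binaryForm d c) = dehomogenize c := by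
  simp [binaryForm, dehomogenize, Polynomial.algebraMap_eq]

theorem aeval_linSubst_binaryForm {a b : k} (ha : a ≠ 0) (c : Fin (d + 1) → k) :
    aeval ![Polynomial.X, 1] (linSubst !![a, b; 0, a] (binaryForm d c))
      = Polynomial.C (a ^ d) *
        (dehomogenize c).comp (Polynomial.X + Polynomial.C (b / a)) := by
  simp only [binaryForm, dehomogenize, map_sum, map_mul, map_pow, linSubst_C, Polynomial.comp,
    Polynomial.eval₂_finsetSum, Finset.mul_sum]
  refine Finset.sum_congr rfl fun j _ => ?_
  have hj : (Polynomial.C a : Polynomial k) ^ d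
      = Polynomial.C a ^ (d - (j : ℕ)) * Polynomial.C a ^ (j : ℕ) := by
    rw [← pow_add, Nat.sub_add_cancel (Nat.lt_succ_iff.1 j.2)]
  have hb : (Polynomial.C b : Polynomial k) = Polynomial.C a * Polynomial.C (b / a) := by
    rw [← map_mul, mul_div_cancel₀ _ ha]
  simp only [linSubst, aeval_X, Fin.sum_univ_two, Matrix.of_apply, Matrix.cons_val_zero,
    Matrix.cons_val_one, map_add, map_mul, aeval_C, Polynomial.algebraMap_eq, mul_one,
    Polynomial.eval₂_mul, Polynomial.eval₂_C, Polynomial.eval₂_pow, Polynomial.eval₂_X, map_zero,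
    zero_mul, zero_add, hj]
  rw [hb, ← mul_add, mul_pow]
  ring

/-- The pairs `(F, G)` fixed up to scalars by a nontrivial Jordan block are combinations of
`(Y^d, 0)` and `(X Y^(d-1), Y^d)`. In terms of `F(x, 1)` and `G(x, 1)`, the latter polynomial
is proportional to its own translate and hence constant, and then the former is affine linear. -/
theorem exists_dehomogenize_of_transvection [CharZero k] (g : GL (Fin 2) k) {a b : k}
    (hb : b ≠ 0) (hg : g.val = !![a, b; 0, a]) {c : k} {w : FormPair k d} (h : g • w = c • w) :
    ∃ α β : k, dehomogenize (fun j => w (1, j)) = Polynomial.C β ∧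
      dehomogenize (fun j => w (0, j)) = Polynomial.C β * Polynomial.X + Polynomial.C α := by
  have ha : a ≠ 0 := by
    rintro rfl
    have := g.det_ne_zero
    rw [hg] at this
    simp at this
  rw [gl_smul_eq_smul_iff, hg, Fin.forall_fin_two] at h
  obtain ⟨h0, h1⟩ := h
  have h0 := congrArg (aeval ![Polynomial.X, (1 : Polynomial k)]) h0
  have h1 := congrArg (aeval ![Polynomial.X, (1 : Polynomial k)]) h1
  simp only [form, map_add, map_mul, aeval_linSubst_binaryForm ha, aeval_binaryForm, aeval_C,
    Polynomial.algebraMap_eq, Fin.sum_univ_two, Matrix.of_apply, Matrix.cons_val_zero,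
    Matrix.cons_val_one, map_zero, zero_mul, zero_add] at h0 h1
  set p := dehomogenize fun j => w (0, j)
  set q := dehomogenize fun j => w (1, j)
  have hCa : (Polynomial.C a⁻¹ : Polynomial k) * Polynomial.C a = 1 := by
    rw [← map_mul, inv_mul_cancel₀ ha, map_one]
  set e := b / a with he
  have he0 : e ≠ 0 := div_ne_zero hb ha
  have hCe : (Polynomial.C e : Polynomial k) = Polynomial.C a⁻¹ * Polynomial.C b := by
    rw [← map_mul, he, div_eq_inv_mul]
  have hq : q = Polynomial.C (a⁻¹ * (c * a ^ d)) * q.comp (Polynomial.X + Polynomial.C e) := by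
    simp only [map_mul, map_pow] at h1 ⊢
    linear_combination Polynomial.C a⁻¹ * h1 - q * hCa
  have hp : p + Polynomial.C e * q
      = Polynomial.C (a⁻¹ * (c * a ^ d)) * p.comp (Polynomial.X + Polynomial.C e) := by
    simp only [map_mul, map_pow] at h0 ⊢
    linear_combination Polynomial.C a⁻¹ * h0 - p * hCa + q * hCe
  obtain ⟨hq1, hq2⟩ := eq_C_of_eq_C_mul_comp he0 hq
  by_cases hq0 : q = 0
  · rw [hq0, mul_zero, add_zero] at hp
    refine ⟨p.eval 0, 0, by simp [hq0], ?_⟩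
    rw [map_zero, zero_mul, zero_add]
    exact (eq_C_of_eq_C_mul_comp he0 hp).1
  · rw [hq2 hq0, map_one, one_mul] at hp
    set β := q.eval 0
    rw [hq1] at hp
    -- Subtracting `β x` from `p` leaves a periodic polynomial.
    have hr : p - Polynomial.C β * Polynomial.X = Polynomial.C 1 *
        (p - Polynomial.C β * Polynomial.X).comp (Polynomial.X + Polynomial.C e) := by
      simp only [Polynomial.sub_comp, Polynomial.mul_comp, Polynomial.C_comp, Polynomial.X_comp,
        map_one, one_mul]
      linear_combination hp
    exact ⟨_, β, hq1, by rw [← (eq_C_of_eq_C_mul_comp he0 hr).1]; ring⟩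

end Fixed

/-! ### Normal forms of nonscalar matrices -/

section NormalForm

/-- The matrix with columns `(1, b)` and `(a, 1)`, with its rows swapped if `ε` holds. Every
ordered pair of distinct points of the projective line is represented by the columns of an
invertible matrix of this form. -/
def frame {R : Type*} [CommRing R] (ε : Bool) (a b : R) : Matrix (Fin 2) (Fin 2) R :=
  if ε then !![b, 1; 1, a] else !![1, a; b, 1]

theorem frame_map {R S : Type*} [CommRing R] [CommRing S] (f : R →+* S) (ε : Bool) (a b : R) :
    (frame ε a b).map f = frame ε (f a) (f b) := by
  cases ε <;> · ext i j; fin_cases i <;> fin_cases j <;> simp [frame]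

variable {k : Type*} [Field k]

theorem exists_frame_of_distinct_eigenvalues {g : Matrix (Fin 2) (Fin 2) k} {x y : k} (hxy : x ≠ y)
    {u v : Fin 2 → k} (hu : u ≠ 0) (hv : v ≠ 0) (hgu : g.mulVec u = x • u)
    (hgv : g.mulVec v = y • v) :
    ∃ (ε : Bool) (a b : k), (frame ε a b).det ≠ 0 ∧
      g * frame ε a b = frame ε a b * !![x, 0; 0, y] := by
  have u0 := congrFun hgu 0
  have u1 := congrFun hgu 1
  have v0 := congrFun hgv 0
  have v1 := congrFun hgv 1
  simp only [Matrix.mulVec, dotProduct, Fin.sum_univ_two, Pi.smul_apply, smul_eq_mul]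
    at u0 u1 v0 v1
  -- Eigenvectors for distinct eigenvalues are linearly independent.
  have hdet : u 0 * v 1 - u 1 * v 0 ≠ 0 := by
    intro h
    have hxy' : x - y ≠ 0 := sub_ne_zero.2 hxy
    have huv : ∀ i j, u i * v j = 0 := by
      intro i j
      refine (mul_eq_zero.1 (?_ : (x - y) * (u i * v j) = 0)).resolve_left hxy'
      fin_cases i <;> fin_cases j <;> simp only [Fin.zero_eta, Fin.mk_one]
      · linear_combination (-v 0) * u0 + u 0 * v0 - g 0 1 * h
      · linear_combination (-v 1) * u0 + u 1 * v0 + (g 0 0 - y) * h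
      · linear_combination (-v 0) * u1 + u 0 * v1 + (y - g 1 1) * h
      · linear_combination (-v 1) * u1 + u 1 * v1 + g 1 0 * h
    obtain ⟨i, hi⟩ := Function.ne_iff.1 hu
    obtain ⟨j, hj⟩ := Function.ne_iff.1 hv
    exact (mul_ne_zero hi hj) (huv i j)
  by_cases h : u 0 * v 1 = 0
  · have h' : u 1 * v 0 ≠ 0 := fun e => hdet (by rw [h, e, sub_zero])
    have hu1 := left_ne_zero_of_mul h'
    have hv0 := right_ne_zero_of_mul h'
    refine ⟨true, v 1 / v 0, u 0 / u 1, ?_, ?_⟩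
    · simp only [frame, if_true, Matrix.det_fin_two_of]
      intro e
      apply hdet
      field_simp at e
      linear_combination e
    · ext i j
      fin_cases i <;> fin_cases j <;> simp [frame, Matrix.mul_apply, Fin.sum_univ_two] <;>
        field_simp
      · linear_combination u0
      · linear_combination v0
      · linear_combination u1
      · linear_combination v1
  · have hu0 := left_ne_zero_of_mul h
    have hv1 := right_ne_zero_of_mul h
    refine ⟨false, v 0 / v 1, u 1 / u 0, ?_, ?_⟩
    · intro e
      apply hdet
      simp only [frame, Bool.false_eq_true, if_false, Matrix.det_fin_two_of] at e
      field_simp at e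
      linear_combination e
    · ext i j
      fin_cases i <;> fin_cases j <;> simp [frame, Matrix.mul_apply, Fin.sum_univ_two] <;>
        field_simp
      · linear_combination u0
      · linear_combination v0
      · linear_combination u1
      · linear_combination v1

/-- The Jordan normal form of a nonscalar `2 × 2` matrix, with a base change from a two-parameter
family. -/
theorem exists_frame_mul_eq [IsAlgClosed k] {g : Matrix (Fin 2) (Fin 2) k}
    (hg : ∀ c : k, g ≠ !![c, 0; 0, c]) :
    ∃ (ε : Bool) (a b : k), (frame ε a b).det ≠ 0 ∧ ∃ x y z : k,
      g * frame ε a b = frame ε a b * !![x, y; 0, z] ∧ (x ≠ z ∧ y = 0 ∨ x = z ∧ y ≠ 0) := by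
  have hev : ∀ x : k, (g 0 0 - x) * (g 1 1 - x) - g 0 1 * g 1 0 = 0 →
      ∃ u : Fin 2 → k, u ≠ 0 ∧ g.mulVec u = x • u := by
    intro x hx
    have h0 : (g - x • (1 : Matrix (Fin 2) (Fin 2) k)).det = 0 := by
      rw [Matrix.det_fin_two]
      simpa using hx
    obtain ⟨u, hu, h⟩ := Matrix.exists_mulVec_eq_zero_iff.2 h0
    refine ⟨u, hu, ?_⟩
    rwa [Matrix.sub_mulVec, Matrix.smul_mulVec, Matrix.one_mulVec, sub_eq_zero] at h
  obtain ⟨x, hx⟩ := IsAlgClosed.exists_root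
    (Polynomial.X ^ 2 - Polynomial.C (g 0 0 + g 1 1) * Polynomial.X
      + Polynomial.C (g 0 0 * g 1 1 - g 0 1 * g 1 0)) (by
        have : (Polynomial.X ^ 2 - Polynomial.C (g 0 0 + g 1 1) * Polynomial.X
          + Polynomial.C (g 0 0 * g 1 1 - g 0 1 * g 1 0)).degree = 2 := by compute_degree!
        rw [this]; decide)
  have hx : (g 0 0 - x) * (g 1 1 - x) - g 0 1 * g 1 0 = 0 := by
    simp [Polynomial.IsRoot] at hx
    linear_combination hx
  obtain ⟨u, hu, hgu⟩ := hev x hx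
  -- The other eigenvalue is determined by the trace.
  by_cases hz : x = g 0 0 + g 1 1 - x
  · have u0 := congrFun hgu 0
    have u1 := congrFun hgu 1
    simp only [Matrix.mulVec, dotProduct, Fin.sum_univ_two, Pi.smul_apply, smul_eq_mul] at u0 u1
    by_cases hu0 : u 0 = 0
    · have hu1 : u 1 ≠ 0 := fun e => hu (by ext i; fin_cases i <;> assumption)
      rw [hu0] at u0 u1
      have e01 : g 0 1 = 0 := by simpa [hu1] using u0
      have e11 : g 1 1 = x := mul_right_cancel₀ hu1 (by linear_combination u1)
      have e00 : g 0 0 = x := by linear_combination -hz - e11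
      refine ⟨true, 0, 0, by simp [frame, Matrix.det_fin_two], x, g 1 0, x, ?_, Or.inr ⟨rfl, ?_⟩⟩
      · ext i j
        fin_cases i <;> fin_cases j <;>
          simp [frame, Matrix.mul_apply, Fin.sum_univ_two, e01, e11, e00]
      · intro e10
        refine hg x ?_
        ext i j
        fin_cases i <;> fin_cases j <;> simp [e01, e11, e00, e10]
    · have e00 : g 0 0 + g 0 1 * (u 1 / u 0) = x := by
        field_simp
        linear_combination u0
      have e10 : g 1 0 + g 1 1 * (u 1 / u 0) = x * (u 1 / u 0) := by
        field_simp
        linear_combination u1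
      refine ⟨false, 0, u 1 / u 0, by simp [frame, Matrix.det_fin_two], x, g 0 1, x, ?_,
        Or.inr ⟨rfl, ?_⟩⟩
      · ext i j
        fin_cases i <;> fin_cases j <;> simp [frame, Matrix.mul_apply, Fin.sum_univ_two]
        · linear_combination e00
        · linear_combination e10
        · linear_combination -hz - e00
      · intro e01
        rw [e01, zero_mul, add_zero] at e00
        have e11 : g 1 1 = x := by linear_combination -hz - e00
        rw [e11] at e10
        refine hg x ?_
        ext i j
        fin_cases i <;> fin_cases j <;>
          simp [e01, e11, e00, show g 1 0 = 0 by linear_combination e10]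
  · obtain ⟨v, hv, hgv⟩ := hev (g 0 0 + g 1 1 - x) (by linear_combination hx)
    obtain ⟨ε, a, b, hdet, h⟩ := exists_frame_of_distinct_eigenvalues hz hu hv hgu hgv
    exact ⟨ε, a, b, hdet, x, 0, _, h, Or.inl ⟨hz, rfl⟩⟩

end NormalForm

/-! ### Parametrization of the automorphism locus -/

section Family

variable {k : Type*} [Field k] {d : ℕ}

/-- The parametrization of the pairs `h ∘ w ∘ adj h`, where `w` is from the column space of the
matrix `B`, with coordinates given by the first `d + 1` parameters, and where `h` is the frame
given by the last two parameters. -/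
def family (ε : Bool) (B : Matrix (Fin 2 × Fin (d + 1)) (Fin (d + 1)) k) :
    Fin 2 × Fin (d + 1) → MvPolynomial (Fin (d + 1) ⊕ Fin 2) k :=
  twist (frame ε (X (Sum.inr 0)) (X (Sum.inr 1)))
    (frame ε (X (Sum.inr 0)) (X (Sum.inr 1))).adjugate
    fun x => ∑ c, C (B x c) * X (Sum.inl c)

theorem aeval_family {R : Type*} [CommRing R] [Algebra k R] (ε : Bool)
    (B : Matrix (Fin 2 × Fin (d + 1)) (Fin (d + 1)) k) (t : Fin (d + 1) ⊕ Fin 2 → R) :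
    (fun x => aeval t (family ε B x)) =
      twist (frame ε (t (Sum.inr 0)) (t (Sum.inr 1)))
        (frame ε (t (Sum.inr 0)) (t (Sum.inr 1))).adjugate
        fun x => ∑ c, algebraMap k R (B x c) * t (Sum.inl c) := by
  funext x
  have h := map_twist (aeval t : MvPolynomial _ k →ₐ[k] R).toRingHom
    (frame ε (X (Sum.inr 0)) (X (Sum.inr 1))) (frame ε (X (Sum.inr 0)) (X (Sum.inr 1))).adjugate
    (fun x => ∑ c, C (B x c) * X (Sum.inl c)) x
  rw [← RingHom.mapMatrix_apply _ (Matrix.adjugate _), RingHom.map_adjugate,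
    RingHom.mapMatrix_apply, frame_map] at h
  simpa [family] using h

theorem eval_family (ε : Bool) (B : Matrix (Fin 2 × Fin (d + 1)) (Fin (d + 1)) k)
    (t : Fin (d + 1) ⊕ Fin 2 → k) :
    (fun x => eval t (family ε B x)) =
      twist (frame ε (t (Sum.inr 0)) (t (Sum.inr 1)))
        (frame ε (t (Sum.inr 0)) (t (Sum.inr 1))).adjugate
        (B.mulVec fun c => t (Sum.inl c)) :=
  aeval_family ε B t

theorem eval_family_of_det_ne_zero (ε : Bool) (B : Matrix (Fin 2 × Fin (d + 1)) (Fin (d + 1)) k)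
    (t : Fin (d + 1) ⊕ Fin 2 → k) (h : (frame ε (t (Sum.inr 0)) (t (Sum.inr 1))).det ≠ 0) :
    (fun x => eval t (family ε B x)) =
      (frame ε (t (Sum.inr 0)) (t (Sum.inr 1))).det ^ d •
        (Matrix.GeneralLinearGroup.mkOfDetNeZero _ h • B.mulVec fun c => t (Sum.inl c)) := by
  rw [eval_family]
  exact twist_adjugate (Matrix.GeneralLinearGroup.mkOfDetNeZero _ h) _

/-- The family is a cone: scaling the first `d + 1` parameters scales its values. -/
theorem exists_eval_family_eq_mul (ε : Bool) (B : Matrix (Fin 2 × Fin (d + 1)) (Fin (d + 1)) k)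
    (t : Fin (d + 1) ⊕ Fin 2 → k) (c : k) :
    ∃ t', ∀ x, eval t' (family ε B x) = c * eval t (family ε B x) := by
  refine ⟨Sum.elim (fun i => c * t (Sum.inl i)) fun i => t (Sum.inr i), fun x => ?_⟩
  have h1 := congrFun (eval_family ε B t) x
  have h2 := congrFun (eval_family ε B
    (Sum.elim (fun i => c * t (Sum.inl i)) fun i => t (Sum.inr i))) x
  have h3 : (B.mulVec fun i => c * t (Sum.inl i)) = c • B.mulVec fun i => t (Sum.inl i) := by
    rw [← Matrix.mulVec_smul]
    rfl
  simp only [Sum.elim_inl, Sum.elim_inr, h3, twist_smul] at h1 h2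
  rw [h1, h2]
  rfl

/-- The coordinate subspace spanned by one of the two monomial pairs `(X^(d-j) Y^j, 0)` and
`(0, X^(d-j) Y^j)` for each `j`, as a column space. An eigenspace of
a diagonal matrix with distinct diagonal entries is contained in such a subspace, because the two
monomial pairs have eigenvalues whose quotient is that of the diagonal entries. -/
def coordMatrix (k : Type*) [Field k] {d : ℕ} (s : Fin (d + 1) → Fin 2) :
    Matrix (Fin 2 × Fin (d + 1)) (Fin (d + 1)) k :=
  Matrix.of fun x c => if x = (s c, c) then 1 else 0

theorem sum_coordMatrix_mul {R : Type*} [CommRing R] [Algebra k R] (s : Fin (d + 1) → Fin 2)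
    (u : Fin (d + 1) → R) (x : Fin 2 × Fin (d + 1)) :
    ∑ c, algebraMap k R (coordMatrix k s x c) * u c = if x.1 = s x.2 then u x.2 else 0 := by
  obtain ⟨i, j⟩ := x
  rw [Finset.sum_eq_single j]
  · simp [coordMatrix]
  · intro l _ hl
    simp [coordMatrix, Ne.symm hl]
  · simp

theorem coordMatrix_mulVec (s : Fin (d + 1) → Fin 2) (u : Fin (d + 1) → k)
    (x : Fin 2 × Fin (d + 1)) :
    (coordMatrix k s).mulVec u x = if x.1 = s x.2 then u x.2 else 0 :=
  sum_coordMatrix_mul (k := k) s u x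

/-- The span of the pairs `(Y^d, 0)` and `(X Y^(d-1), Y^d)` as a column space, in the columns
`d` and `d - 1`. -/
def transvectionMatrix (k : Type*) [Field k] (d : ℕ) :
    Matrix (Fin 2 × Fin (d + 1)) (Fin (d + 1)) k :=
  Matrix.of fun x c =>
    if x.1 = 0 then if c = x.2 ∧ d ≤ (c : ℕ) + 1 then 1 else 0
    else if (x.2 : ℕ) = d ∧ (c : ℕ) + 1 = d then 1 else 0

/-- The matrices whose column spaces contain all pairs fixed up to scalars by a nonscalar matrix in
Jordan normal form. -/
def baseMatrix (k : Type*) [Field k] (d : ℕ) :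
    Option (Fin (d + 1) → Fin 2) → Matrix (Fin 2 × Fin (d + 1)) (Fin (d + 1)) k
  | none => transvectionMatrix k d
  | some s => coordMatrix k s

theorem exists_coordMatrix_mulVec (g : GL (Fin 2) k) {x z : k} (hxz : x ≠ z)
    (hg : g.val = !![x, 0; 0, z]) {c : k} {w : FormPair k d} (h : g • w = c • w) :
    ∃ s u, w = (coordMatrix k s).mulVec u := by
  rw [diagonal_smul_eq_smul_iff g hg] at h
  have hzero : ∀ j, w (0, j) = 0 ∨ w (1, j) = 0 := by
    intro j
    by_contra! hj
    obtain ⟨h0, h1⟩ := h j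
    apply hxz
    rw [← mul_assoc] at h0 h1
    exact (mul_right_cancel₀ hj.1 h0).trans (mul_right_cancel₀ hj.2 h1).symm
  classical
  refine ⟨fun j => if w (1, j) = 0 then 0 else 1,
    fun j => if w (1, j) = 0 then w (0, j) else w (1, j), ?_⟩
  funext ⟨i, j⟩
  rw [coordMatrix_mulVec]
  have := hzero j
  fin_cases i <;> by_cases h1 : w (1, j) = 0 <;> simp_all

theorem exists_transvectionMatrix_mulVec [CharZero k] (hd : 1 ≤ d) (g : GL (Fin 2) k) {x y : k}
    (hy : y ≠ 0) (hg : g.val = !![x, y; 0, x]) {c : k} {w : FormPair k d} (h : g • w = c • w) :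
    ∃ u, w = (transvectionMatrix k d).mulVec u := by
  obtain ⟨α, β, hq, hp⟩ := exists_dehomogenize_of_transvection g hy hg h
  have hq : ∀ j : Fin (d + 1), w (1, j) = if (j : ℕ) = d then β else 0 := by
    intro j
    rw [← coeff_dehomogenize (fun j => w (1, j)) j, hq, Polynomial.coeff_C]
    have := j.2
    simp only [show d - (j : ℕ) = 0 ↔ (j : ℕ) = d by omega]
  have hp : ∀ j : Fin (d + 1), w (0, j)
      = (if (j : ℕ) + 1 = d then β else 0) + if (j : ℕ) = d then α else 0 := by
    intro j
    rw [← coeff_dehomogenize (fun j => w (0, j)) j, hp, Polynomial.coeff_add,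
      Polynomial.coeff_C_mul, Polynomial.coeff_X, Polynomial.coeff_C]
    have := j.2
    simp only [show d - (j : ℕ) = 0 ↔ (j : ℕ) = d by omega,
      show 1 = d - (j : ℕ) ↔ (j : ℕ) + 1 = d by omega]
    simp
  refine ⟨fun j => w (0, j), ?_⟩
  funext ⟨i, j⟩
  have hj := j.2
  fin_cases i
  · simp only [Fin.zero_eta, Matrix.mulVec, dotProduct, transvectionMatrix, Matrix.of_apply,
      if_true]
    rw [Finset.sum_eq_single j]
    · by_cases h1 : d ≤ (j : ℕ) + 1
      · simp [h1]
      · simp [h1, hp, show ¬ (j : ℕ) + 1 = d by omega, show ¬ (j : ℕ) = d by omega]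
    · intro l _ hl
      simp [hl]
    · simp
  · simp only [Fin.mk_one, Matrix.mulVec, dotProduct, transvectionMatrix, Matrix.of_apply,
      one_ne_zero, if_false]
    rw [Finset.sum_eq_single ⟨d - 1, by omega⟩]
    · simp [hq, hp, show d - 1 + 1 = d by omega, show ¬ d - 1 = d by omega]
    · intro l _ hl
      rw [if_neg, zero_mul]
      exact fun e => hl (Fin.ext (by dsimp only; omega))
    · simp

/-- A point of the automorphism locus is represented by an eigenvector of a nonscalar matrix. -/
theorem exists_of_mem_automorphismLocus {φ : ℙ k (FormPair k d)}
    (hφ : φ ∈ automorphismLocus k d) :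
    ∃ (g : GL (Fin 2) k) (c : k) (v : FormPair k d) (hv : v ≠ 0),
      φ = Projectivization.mk k v hv ∧ (∀ a : k, g.val ≠ !![a, 0; 0, a]) ∧ g • v = c • v := by
  obtain ⟨⟨p, hp⟩, hp1⟩ := Subgroup.ne_bot_iff_exists_ne_one.1 hφ
  obtain ⟨g, rfl⟩ := Matrix.ProjGenLinGroup.mk_surjective p
  induction φ using Projectivization.ind with | h v hv =>
  rw [MulAction.mem_stabilizer_iff, pgl_smul_mk, Projectivization.mk_eq_mk_iff'] at hp
  obtain ⟨c, hc⟩ := hp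
  refine ⟨g, c, v, hv, rfl, fun a ha => hp1 ?_, hc.symm⟩
  have ha0 : a ≠ 0 := by
    rintro rfl
    have := g.det_ne_zero
    rw [ha] at this
    simp at this
  have hg : g = Matrix.GeneralLinearGroup.scalar (Fin 2) (Units.mk0 a ha0) := by
    ext i j
    rw [ha]
    fin_cases i <;> fin_cases j <;> simp
  refine Subtype.ext ?_
  change Matrix.ProjGenLinGroup.mk g = 1
  rw [hg, Matrix.ProjGenLinGroup.mk_scalar]

/-- The automorphism locus is covered by finitely many families with `d + 3` parameters. -/
theorem exists_mem_paramImage_family [IsAlgClosed k] [CharZero k] (hd : 1 ≤ d)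
    {φ : ℙ k (FormPair k d)} (hφ : φ ∈ automorphismLocus k d) :
    ∃ ε s, φ ∈ paramImage (family ε (baseMatrix k d s)) := by
  obtain ⟨g, c, v, hv, rfl, hg, hgv⟩ := exists_of_mem_automorphismLocus hφ
  obtain ⟨ε, a, b, hdet, x, y, z, hmul, hxyz⟩ := exists_frame_mul_eq hg
  let h := Matrix.GeneralLinearGroup.mkOfDetNeZero _ hdet
  have hK : (h⁻¹ * g * h).val = !![x, y; 0, z] := by
    rw [mul_assoc, Units.val_mul, Units.val_mul]
    change (h⁻¹).val * (g.val * frame ε a b) = _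
    rw [hmul, ← mul_assoc]
    change (h⁻¹).val * h.val * _ = _
    rw [← Units.val_mul, inv_mul_cancel, Units.val_one, one_mul]
  have hw : (h⁻¹ * g * h) • (h⁻¹ • v) = c • (h⁻¹ • v) := by
    rw [← mul_smul, mul_assoc, mul_inv_cancel, mul_one, mul_smul, hgv, smul_comm]
  obtain ⟨s, u, hu⟩ : ∃ s u, h⁻¹ • v = (baseMatrix k d s).mulVec u := by
    rcases hxyz with ⟨hxz, rfl⟩ | ⟨rfl, hy⟩
    · obtain ⟨s, u, hu⟩ := exists_coordMatrix_mulVec _ hxz hK hw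
      exact ⟨some s, u, hu⟩
    · obtain ⟨u, hu⟩ := exists_transvectionMatrix_mulVec hd _ hy hK hw
      exact ⟨none, u, hu⟩
  have he := eval_family_of_det_ne_zero ε (baseMatrix k d s) (Sum.elim u ![a, b]) hdet
  have hv' : v = h • (baseMatrix k d s).mulVec u := by rw [← hu, smul_inv_smul]
  change _ = (frame ε a b).det ^ d • (h • (baseMatrix k d s).mulVec u) at he
  rw [← hv'] at he
  have hne : (frame ε a b).det ^ d ≠ 0 := pow_ne_zero _ hdet
  refine ⟨ε, s, Sum.elim u ![a, b], by rw [he]; exact smul_ne_zero hne hv, ?_⟩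
  rw [Projectivization.mk_eq_mk_iff']
  refine ⟨((frame ε a b).det ^ d)⁻¹, ?_⟩
  rw [he, smul_smul, inv_mul_cancel₀ hne, one_smul]

end Family

/-! ### The family of pairs fixed by an involution -/

section Involution

theorem substCoeff_zero {R : Type*} [CommRing R] {d : ℕ} (N : Matrix (Fin 2) (Fin 2) R)
    (j : Fin (d + 1)) :
    substCoeff N 0 j = N 0 0 ^ (d - (j : ℕ)) * N 0 1 ^ (j : ℕ) * (d.choose j : R) := by
  have hj := j.2
  have hterm : ∀ m : ℕ, ((C (N 0 0) * X 0) ^ m * (C (N 0 1) * X 1) ^ (d - m) *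
      ((d.choose m : ℕ) : MvPolynomial (Fin 2) R) : MvPolynomial (Fin 2) R)
      = monomial (Finsupp.single 0 m + Finsupp.single 1 (d - m))
        (N 0 0 ^ m * N 0 1 ^ (d - m) * (d.choose m : R)) := by
    intro m
    rw [mul_pow, mul_pow, X_pow_eq_monomial, X_pow_eq_monomial, ← C_pow, ← C_pow, C_mul_monomial,
      C_mul_monomial, monomial_mul, ← map_natCast (C : R →+* MvPolynomial (Fin 2) R),
      mul_comm _ (C _), C_mul_monomial]
    congr 1
    ring
  simp only [substCoeff, Fin.val_zero, Nat.sub_zero, pow_zero, mul_one, Fin.sum_univ_two]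
  rw [add_pow, coeff_sum, Finset.sum_eq_single (d - (j : ℕ))]
  · rw [hterm, show d - (d - (j : ℕ)) = j by omega, coeff_monomial, if_pos rfl,
      Nat.choose_symm (by omega)]
  · intro m hm hne
    rw [hterm, coeff_monomial, if_neg]
    intro h
    have := DFunLike.congr_fun h 0
    simp at this
    omega
  · intro h
    simp at h

theorem twist_one_one {R : Type*} [CommRing R] {d : ℕ} (v : Fin 2 × Fin (d + 1) → R) :
    twist 1 1 v = v := by
  have h : ∀ q j : Fin (d + 1), substCoeff (1 : Matrix (Fin 2) (Fin 2) R) q j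
      = if q = j then 1 else 0 := by
    intro q j
    simp only [substCoeff, Fin.sum_univ_two, Matrix.one_apply_eq, ne_eq, zero_ne_one,
      one_ne_zero, not_false_eq_true, Matrix.one_apply_ne, map_one, map_zero, one_mul, zero_mul,
      add_zero, zero_add]
    rw [X_pow_eq_monomial, X_pow_eq_monomial, monomial_mul, coeff_monomial, one_mul]
    refine if_congr ⟨fun h => ?_, fun h => by rw [h]⟩ rfl rfl
    have := DFunLike.congr_fun h 1
    simp at this
    exact Fin.ext this
  funext ⟨i, j⟩
  simp [twist, h, Matrix.one_apply]

variable {k : Type*} [Field k]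

/-- A partial derivative is the derivative along a coordinate line. -/
theorem eval_pderiv_eq_derivative_eval {ι : Type*} [DecidableEq ι] (p : ι → k) (y : ι)
    (f : MvPolynomial ι k) :
    eval p (pderiv y f) = (Polynomial.derivative
      (aeval (fun z => Polynomial.C (p z) + if z = y then Polynomial.X else 0) f)).eval 0 := by
  have h0 : ∀ f : MvPolynomial ι k, (aeval (fun z => Polynomial.C (p z)
      + if z = y then Polynomial.X else 0) f : Polynomial k).eval 0 = eval p f := by
    intro f
    induction f using MvPolynomial.induction_on with
    | C a => simp [Polynomial.algebraMap_eq]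
    | add f g hf hg => rw [map_add, map_add, Polynomial.eval_add, hf, hg]
    | mul_X f i hf =>
      rw [map_mul, map_mul, Polynomial.eval_mul, hf, aeval_X, eval_X]
      split_ifs <;> simp
  induction f using MvPolynomial.induction_on with
  | C a => simp [Polynomial.algebraMap_eq]
  | add f g hf hg => rw [map_add, map_add, map_add, map_add, Polynomial.eval_add, hf, hg]
  | mul_X f i hf =>
    rw [pderiv_mul, map_add, map_mul, map_mul, map_mul, hf, Polynomial.derivative_mul,
      Polynomial.eval_add, Polynomial.eval_mul, Polynomial.eval_mul, h0, aeval_X, pderiv_X, eval_X]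
    by_cases h : i = y
    · subst h; simp [h0]
    · simp [h]

variable {d : ℕ}

/-- The parity of the index of a coefficient. The pairs `(F, G)` with `F` even and `G` odd in `Y`
are spanned by the monomials `X^(d-j) Y^j` in the component given by the parity of `j`. -/
def parity (j : Fin (d + 1)) : Fin 2 :=
  if Even (j : ℕ) then 0 else 1

/-- The parameters of the pair `(X^d, 0)` with the identity matrix as the frame. -/
def basePoint (k : Type*) [Field k] (d : ℕ) : Fin (d + 1) ⊕ Fin 2 → k :=
  Sum.elim (Pi.single 0 1) 0

theorem pderiv_inl_family (l : Fin (d + 1)) (x : Fin 2 × Fin (d + 1)) :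
    eval (basePoint k d) (pderiv (Sum.inl l) (family false (coordMatrix k parity) x))
      = if x.1 = parity x.2 ∧ x.2 = l then 1 else 0 := by
  have hf : frame false (0 : Polynomial k) 0 = 1 := by
    ext i j; fin_cases i <;> fin_cases j <;> simp [frame]
  rw [eval_pderiv_eq_derivative_eval]
  have h := congrFun (aeval_family false (coordMatrix k parity) fun z =>
    Polynomial.C (basePoint k d z) + if z = Sum.inl l then Polynomial.X else 0) x
  rw [h]
  simp only [sum_coordMatrix_mul, basePoint, Sum.elim_inr, Pi.zero_apply, map_zero, reduceCtorEq,
    if_false, add_zero, hf, Matrix.adjugate_one, twist_one_one]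
  obtain ⟨i, j⟩ := x
  clear h
  dsimp only
  by_cases h1 : i = parity j
  · by_cases h2 : j = l <;> simp [h1, h2]
  · simp [h1]

theorem pderiv_inr_family (r : Fin 2) (x : Fin 2 × Fin (d + 1)) :
    eval (basePoint k d) (pderiv (Sum.inr r) (family false (coordMatrix k parity) x))
      = if r = 0 then if x.1 = 0 ∧ (x.2 : ℕ) = 1 then -(d : k) else 0
        else if x.1 = 1 ∧ (x.2 : ℕ) = 0 then 1 else 0 := by
  obtain ⟨i, j⟩ := x
  rw [eval_pderiv_eq_derivative_eval]
  have h := congrFun (aeval_family false (coordMatrix k parity) fun z =>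
    Polynomial.C (basePoint k d z) + if z = Sum.inr r then Polynomial.X else 0) (i, j)
  rw [h]
  have hw : ∀ x : Fin 2 × Fin (d + 1), (if x.1 = parity x.2 then
      (Polynomial.C (Pi.single (M := fun _ => k) 0 1 x.2) : Polynomial k) else 0)
        = if x = (0, 0) then 1 else 0 := by
    rintro ⟨i, j⟩
    by_cases hj : j = 0
    · subst hj; simp [parity]
    · simp [hj]
  have ht : ∀ M N : Matrix (Fin 2) (Fin 2) (Polynomial k),
      twist M N (fun x : Fin 2 × Fin (d + 1) => if x = (0, 0) then (1 : Polynomial k) else 0) (i, j)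
        = M i 0 * (N 0 0 ^ (d - (j : ℕ)) * N 0 1 ^ (j : ℕ) * (d.choose j : Polynomial k)) := by
    intro M N
    rw [twist, Finset.sum_eq_single 0, Finset.sum_eq_single 0, substCoeff_zero]
    · simp
    · intro q _ hq; simp [hq]
    · simp
    · intro l _ hl; simp [hl]
    · simp
  simp only [sum_coordMatrix_mul, basePoint, Sum.elim_inl, Sum.elim_inr, Pi.zero_apply, map_zero,
    reduceCtorEq, if_false, add_zero, zero_add, hw, ht, Sum.inr.injEq]
  clear h hw ht
  obtain ⟨j, hj⟩ := j
  rcases j with _ | _ | j <;> fin_cases r <;> fin_cases i <;>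
    simp [frame, Matrix.adjugate_fin_two_of, Polynomial.derivative_pow]

/-- The Jacobian matrix of suitable `d + 3` coordinates of the family at the base point is diagonal,
with diagonal entries `1` and `-d`. -/
theorem algebraicIndependent_family [CharZero k] (hd : 1 ≤ d) :
    AlgebraicIndependent k fun z : Fin (d + 1) ⊕ Fin 2 => family false (coordMatrix k parity)
      (Sum.elim (fun j => (parity j, j)) ![(0, ⟨1, by omega⟩), (1, 0)] z) := by
  refine algebraicIndependent_of_det_pderiv_ne_zero _ (basePoint k d) ?_
  have hJ : (Matrix.of fun z y => eval (basePoint k d) (pderiv y (family false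
      (coordMatrix k parity)
      (Sum.elim (fun j => (parity j, j)) ![(0, ⟨1, by omega⟩), (1, 0)] z))))
      = Matrix.diagonal (Sum.elim (fun _ : Fin (d + 1) => (1 : k)) ![-(d : k), 1]) := by
    ext z y
    rw [Matrix.of_apply, Matrix.diagonal_apply]
    rcases y with l | r
    · rw [pderiv_inl_family]
      rcases z with j | q
      · simp
      · fin_cases q <;> simp [parity]
    · rw [pderiv_inr_family]
      rcases z with j | q
      · fin_cases r
        · simp [parity]
          intro h1 h2
          simp [h2] at h1
        · simp [parity]
          rintro h1 rfl
          simp at h1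
      · fin_cases q <;> fin_cases r <;> simp
  rw [hJ, Matrix.det_diagonal]
  simp
  omega

/-- The conjugate of `diag(1, -1)` by the frame `h` fixes `h ∘ w ∘ adj h` if `w` consists of a
form even in `Y` and a form odd in `Y`. -/
theorem mem_automorphismLocus_of_det_ne_zero [CharZero k] (t : Fin (d + 1) ⊕ Fin 2 → k)
    (ht : (fun x => eval t (family false (coordMatrix k parity) x)) ≠ 0)
    (hdet : (frame false (t (Sum.inr 0)) (t (Sum.inr 1))).det ≠ 0) :
    Projectivization.mk k _ ht ∈ automorphismLocus k d := by
  let h := Matrix.GeneralLinearGroup.mkOfDetNeZero _ hdet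
  let D : GL (Fin 2) k := Matrix.GeneralLinearGroup.mkOfDetNeZero !![1, 0; 0, -1] (by simp)
  have hDw : D • (coordMatrix k parity).mulVec (fun c : Fin (d + 1) => t (Sum.inl c))
      = (1 : k) • (coordMatrix k parity).mulVec fun c => t (Sum.inl c) := by
    rw [diagonal_smul_eq_smul_iff D rfl]
    intro j
    simp only [coordMatrix_mulVec, parity]
    by_cases hj : Even (j : ℕ)
    · simp [hj, hj.neg_one_pow]
    · simp [hj, (Nat.not_even_iff_odd.1 hj).neg_one_pow]
  rw [one_smul] at hDw
  have hfix : (h * D * h⁻¹) • (fun x => eval t (family false (coordMatrix k parity) x))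
      = fun x => eval t (family false (coordMatrix k parity) x) := by
    rw [eval_family_of_det_ne_zero _ _ t hdet]
    change (h * D * h⁻¹) • ((_ : k) • (h • _)) = (_ : k) • (h • _)
    rw [smul_comm, ← mul_smul, inv_mul_cancel_right, mul_smul, hDw]
  change MulAction.stabilizer _ _ ≠ ⊥
  rw [Subgroup.ne_bot_iff_exists_ne_one]
  refine ⟨⟨Matrix.ProjGenLinGroup.mk (h * D * h⁻¹), ?_⟩, fun h1 => ?_⟩
  · rw [MulAction.mem_stabilizer_iff, pgl_smul_mk]
    simp only [hfix]
  · have h2 : Matrix.ProjGenLinGroup.mk (h * D * h⁻¹) = 1 := congrArg Subtype.val h1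
    rw [map_mul, map_mul, map_inv, mul_inv_eq_one, mul_eq_left,
      ← Matrix.ProjGenLinGroup.mk_one, eq_comm, Matrix.ProjGenLinGroup.mk_eq_mk_iff] at h2
    obtain ⟨u, hu⟩ := h2
    have e0 := congrArg (fun g : GL (Fin 2) k => g.val 0 0) hu
    have e1 := congrArg (fun g : GL (Fin 2) k => g.val 1 1) hu
    simp [D] at e0 e1
    rw [e0] at e1
    have e2 : (1 : k) = -1 := congrArg Units.val e1
    norm_num at e2

theorem paramImage_family_nonempty :
    (paramImage (family false (coordMatrix k (parity (d := d))))).Nonempty := by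
  have hdet : (frame false (basePoint k d (Sum.inr 0)) (basePoint k d (Sum.inr 1))).det ≠ 0 := by
    simp [frame, basePoint]
  refine ⟨_, basePoint k d, ?_, rfl⟩
  rw [eval_family_of_det_ne_zero _ _ _ hdet]
  refine smul_ne_zero (pow_ne_zero _ hdet) ((smul_ne_zero_iff_ne _).2 fun h => ?_)
  have := congrFun h (0, 0)
  simp [coordMatrix_mulVec, parity, basePoint] at this

theorem paramImage_family_subset_closure [CharZero k] :
    paramImage (family false (coordMatrix k (parity (d := d))))
      ⊆ closure (automorphismLocus k d) := by
  refine paramImage_subset_closure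
    (D := (frame false (X (Sum.inr 0)) (X (Sum.inr 1)) : Matrix _ _ (MvPolynomial _ k)).det)
    (fun h => ?_) fun t ht hD => mem_automorphismLocus_of_det_ne_zero t ht ?_
  · have := congrArg (eval (0 : Fin (d + 1) ⊕ Fin 2 → k)) h
    simp [frame, Matrix.det_fin_two] at this
  · rw [RingHom.map_det, RingHom.mapMatrix_apply, frame_map, eval_X, eval_X] at hD
    exact hD

end Involution

/-! ### The codimension of the automorphism locus -/

section Codimension

variable {k : Type*} [Field k] [IsAlgClosed k] [CharZero k] {d : ℕ}

/-- An irreducible closed set in the closure of the automorphism locus lies in the closure of one of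
the finitely many families that cover the locus. -/
theorem le_coheight_of_subset_closure (hd : 1 ≤ d)
    (Z : TopologicalSpace.IrreducibleCloseds (ℙ k (FormPair k d)))
    (hZ : (Z : Set (ℙ k (FormPair k d))) ⊆ closure (automorphismLocus k d)) :
    ((d - 1 : ℕ) : ℕ∞) ≤ Order.coheight Z := by
  classical
  let W : Bool × Option (Fin (d + 1) → Fin 2) → Set (ℙ k (FormPair k d)) :=
    fun x => closure (paramImage (family x.1 (baseMatrix k d x.2)))
  have hW : closure (automorphismLocus k d) ⊆ ⋃ x, W x := by
    refine closure_minimal (fun φ hφ => ?_)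
      (isClosed_iUnion_of_finite fun x => isClosed_closure)
    obtain ⟨ε, s, h⟩ := exists_mem_paramImage_family hd hφ
    exact Set.mem_iUnion.2 ⟨(ε, s), subset_closure h⟩
  obtain ⟨_, hmem, hsub⟩ := isIrreducible_iff_sUnion_isClosed.1 Z.isIrreducible
    (Finset.univ.image W) (fun z hz => by
      obtain ⟨x, -, rfl⟩ := Finset.mem_image.1 hz
      exact isClosed_closure) (by simpa using hZ.trans hW)
  obtain ⟨⟨ε, s⟩, -, rfl⟩ := Finset.mem_image.1 hmem
  have hne : (paramImage (family ε (baseMatrix k d s))).Nonempty :=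
    closure_nonempty_iff.1 (Z.isIrreducible.nonempty.mono hsub)
  have hle : Z ≤ paramClosure _ hne := hsub
  refine le_trans (le_coheight_paramClosure hne (exists_eval_family_eq_mul ε _) ?_)
    (Order.coheight_anti hle)
  simp
  omega

theorem codim_automorphismLocus_le (hd : 1 ≤ d) :
    codim (automorphismLocus k d) ≤ ((d - 1 : ℕ) : ℕ∞) := by
  refine (iInf₂_le (paramClosure _ paramImage_family_nonempty)
    (closure_minimal paramImage_family_subset_closure isClosed_closure)).trans ?_
  refine coheight_paramClosure_le _ (algebraicIndependent_family hd) ?_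
  simp
  omega

end Codimension

end RationalMaps

end

theorem mainTheorem9 (k : Type*) [Field k] [IsAlgClosed k] [CharZero k] (d : ℕ) (hd : 1 ≤ d) :
    RationalMaps.codim (RationalMaps.automorphismLocus k d) = ((d - 1 : ℕ) : ℕ∞) ∧
    ∀ Z : Set (ℙ k (RationalMaps.FormPair k d)),
      Maximal (fun W => W ⊆ RationalMaps.automorphismLocus k d ∧ IsIrreducible W) Z →
      ((d - 1 : ℕ) : ℕ∞) ≤ RationalMaps.codim Z := by
  refine ⟨le_antisymm (RationalMaps.codim_automorphismLocus_le hd) (le_iInf₂ fun W hW =>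
    RationalMaps.le_coheight_of_subset_closure hd W hW), fun Z hZ => le_iInf₂ fun W hW =>
    RationalMaps.le_coheight_of_subset_closure hd W (hW.trans (closure_mono hZ.prop.1))⟩
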